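/- Let $l>0$ and let $V\in L^2[0,l]$ be real-valued. Let $D$ be the Dirichlet operator in $L^2[0,l]$, $Df=-f''+Vf$, $\operatorname{dom}D=\{f\in H^2[0,l]: f(0)=f(l)=0\}$, and let $\mu_0<\mu_1<\mu_2<\dots$ be its eigenvalues (they are real and form such an infinite sequence). For $z\in\mathbb C\setminus\operatorname{spec}D$ let the Krein matrix $s(z)=(s_{jk}(z))_{j,k=1,2}$ be the (well-defined) complex $2\times2$ matrix such that $$\begin{pmatrix} f'(0)\\ -f'(l)\end{pmatrix}=s(z)\begin{pmatrix} f(0)\\ f(l)\end{pmatrix}$$ for every $f\in H^2[0,l]$ with $-f''+Vf=zf$. For $\alpha\in\mathbb R$ and $\beta\in\mathbb R\setminus\{0\}$ let $$P=-\frac{d^2}{dt^2}+W+\frac{\alpha}{1+\beta^2}\sum_{k\in\mathbb Z}\delta(\,\cdot\,-kl),$$ where $W$ is the $l$-periodic extension of $V|_{[0,l)}$ to $\mathbb R$; that is, $P$ acts as $f\mapsto -f''+Wf$ on functions that are $H^2$ on each cell $[kl,(k+1)l]$ and satisfy $f(kl+)=f(kl-)$ and $f'(kl+)=f'(kl-)+\frac{\alpha}{1+\beta^2}f(kl)$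 for all $k\in\mathbb Z$. Its discriminant at $z\in\mathbb C$ is $y_1'(l+;z)+y_2(l+;z)$, where $y_1,y_2$ are the solutions on $\mathbb R$ of $(P-z)y=0$ (with no integrability at infinity required) with $y_1(0+;z)=y_2'(0+;z)=0$ and $y_1'(0+;z)=y_2(0+;z)=1$. Then: (A) $s_{12}(z)\neq0$ for all $z\in\mathbb C\setminus\operatorname{spec}D$. (B) For all $\alpha\in\mathbb R$ and $\beta\in\mathbb R\setminus\{0\}$ the function $$\eta(z)=\frac{\alpha}{s_{12}(z)}-(1+\beta^2)\,\frac{s_{11}(z)+s_{22}(z)}{s_{12}(z)},\qquad z\in\mathbb C\setminus\operatorname{spec}D,$$ extends to an entire function, again denoted by $\eta$. (C) $\frac1{1+\beta^2}\,\eta(z)$ is the discriminant of $P$ at $z$, for every $z\in\mathbb C$. (D) $\eta$ is real on the real axis, $\eta(\mu_k)\le-2(1+\beta^2)$ for even $k$, and $\eta(\mu_k)\ge2(1+\beta^2)$ for odd $k$. (E) $\eta'(z)\neq0$ for every real $z$ with $|\eta(z)|<2(1+\beta^2)$. Moreover, the restriction of $\eta$ to the real axis has no local minimum with value $2(1+\beta^2)$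 and no local maximum with value $-2(1+\beta^2)$. -/

import Mathlib

open MeasureTheory

noncomputable section

namespace KreinKP

/-- The function `y` belongs to the Sobolev space `H²[a,b]`, with first derivative `p` on `[a,b]`
(one-sided at the end points) and second weak derivative `g`: `y` is differentiable with
derivative `p`, and `p` is absolutely continuous with derivative `g ∈ L²`. -/
structure IsH2 (a b : ℝ) (y p g : ℝ → ℂ) : Prop where
  memLp : MemLp g 2 (volume.restrict (Set.Icc a b))
  hasDeriv : ∀ t ∈ Set.Icc a b, HasDerivWithinAt y (p t) (Set.Icc a b) t
  deriv_eq : ∀ t ∈ Set.Icc a b, p t = p a + ∫ s in a..t, g s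

theorem IsH2.zero (a b : ℝ) : IsH2 a b (fun _ => 0) (fun _ => 0) (fun _ => 0) where
  memLp := MemLp.zero'
  hasDeriv := fun t _ => hasDerivWithinAt_const t _ 0
  deriv_eq := by simp

theorem IsH2.intervalIntegrable {a b : ℝ} {y p g : ℝ → ℂ} (h : IsH2 a b y p g) {t : ℝ}
    (ht : t ∈ Set.Icc a b) : IntervalIntegrable g volume a t := by
  have h1 : IntegrableOn g (Set.Icc a b) volume := h.memLp.integrable (by norm_num)
  rw [intervalIntegrable_iff_integrableOn_Icc_of_le ht.1]
  exact h1.mono_set (Set.Icc_subset_Icc_right ht.2)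

theorem IsH2.add {a b : ℝ} {y p g y' p' g' : ℝ → ℂ} (h : IsH2 a b y p g)
    (h' : IsH2 a b y' p' g') : IsH2 a b (y + y') (p + p') (g + g') where
  memLp := h.memLp.add h'.memLp
  hasDeriv := fun t ht => (h.hasDeriv t ht).add (h'.hasDeriv t ht)
  deriv_eq := fun t ht => by
    simp only [Pi.add_apply]
    rw [intervalIntegral.integral_add (h.intervalIntegrable ht) (h'.intervalIntegrable ht),
      h.deriv_eq t ht, h'.deriv_eq t ht]
    ring

theorem IsH2.smul {a b : ℝ} {y p g : ℝ → ℂ} (c : ℂ) (h : IsH2 a b y p g) :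
    IsH2 a b (c • y) (c • p) (c • g) where
  memLp := h.memLp.const_smul c
  hasDeriv := fun t ht => (h.hasDeriv t ht).const_smul c
  deriv_eq := fun t ht => by
    simp only [Pi.smul_apply]
    rw [intervalIntegral.integral_smul, h.deriv_eq t ht, smul_add]

/-- The Hilbert space `L²[0,l]` of complex-valued functions. -/
abbrev L2 (l : ℝ) : Type := Lp ℂ 2 (volume.restrict (Set.Icc (0 : ℝ) l))

/-- The graph of the Dirichlet operator `D f = -f'' + V f`,
`dom D = {f ∈ H²[0,l] : f(0) = f(l) = 0}`, in `L²[0,l]`. -/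
def dirichletGraph (l : ℝ) (V : ℝ → ℝ) : Submodule ℂ (L2 l × L2 l) where
  carrier := {uv | ∃ y p g : ℝ → ℂ, IsH2 0 l y p g ∧ y 0 = 0 ∧ y l = 0 ∧
    (uv.1 : ℝ → ℂ) =ᵐ[volume.restrict (Set.Icc 0 l)] y ∧
    (uv.2 : ℝ → ℂ) =ᵐ[volume.restrict (Set.Icc 0 l)] fun t => -g t + (V t : ℂ) * y t}
  zero_mem' := by
    refine ⟨_, _, _, IsH2.zero 0 l, rfl, rfl, ?_, ?_⟩
    · exact Lp.coeFn_zero _ _ _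
    · filter_upwards [Lp.coeFn_zero ℂ 2 (volume.restrict (Set.Icc (0 : ℝ) l))] with t ht
      simpa using ht
  add_mem' := by
    rintro ⟨u, v⟩ ⟨u', v'⟩ ⟨y, p, g, h, h0, hl, hu, hv⟩ ⟨y', p', g', h', h0', hl', hu', hv'⟩
    refine ⟨_, _, _, h.add h', by simp [h0, h0'], by simp [hl, hl'], ?_, ?_⟩
    · filter_upwards [Lp.coeFn_add u u', hu, hu'] with t h1 h2 h3
      simp only [Prod.fst_add, Pi.add_apply] at *
      rw [h1, h2, h3]
    · filter_upwards [Lp.coeFn_add v v', hv, hv'] with t h1 h2 h3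
      simp only [Prod.snd_add, Pi.add_apply] at *
      rw [h1, h2, h3]
      ring
  smul_mem' := by
    rintro c ⟨u, v⟩ ⟨y, p, g, h, h0, hl, hu, hv⟩
    refine ⟨_, _, _, h.smul c, by simp [h0], by simp [hl], ?_, ?_⟩
    · filter_upwards [Lp.coeFn_smul c u, hu] with t h1 h2
      simp only [Prod.smul_fst, Pi.smul_apply] at *
      rw [h1, h2]
    · filter_upwards [Lp.coeFn_smul c v, hv] with t h1 h2
      simp only [Prod.smul_snd, Pi.smul_apply, smul_eq_mul] at *
      rw [h1, h2]
      ring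

/-- The Dirichlet operator `D` as an unbounded operator in `L²[0,l]`. -/
def dirichletOp (l : ℝ) (V : ℝ → ℝ) : L2 l →ₗ.[ℂ] L2 l := (dirichletGraph l V).toLinearPMap

theorem dirichletGraph_functional {l : ℝ} (hl : 0 < l) (V : ℝ → ℝ) :
    ∀ x ∈ dirichletGraph l V, x.1 = 0 → x.2 = 0 := by
  rintro ⟨u, v⟩ ⟨y, p, g, h, -, -, hu, hv⟩ (rfl : u = 0)
  have hyc : ContinuousOn y (Set.Icc 0 l) := fun t ht => (h.hasDeriv t ht).continuousWithinAt
  have hy0 : y =ᵐ[volume.restrict (Set.Icc 0 l)] (fun _ => (0 : ℂ)) := by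
    filter_upwards [hu, Lp.coeFn_zero ℂ 2 (volume.restrict (Set.Icc (0 : ℝ) l))] with t h1 h2
    rw [← h1]
    simpa using h2
  have hy : Set.EqOn y (fun _ => (0 : ℂ)) (Set.Icc 0 l) :=
    Measure.eqOn_Icc_of_ae_eq volume hl.ne hy0 hyc continuousOn_const
  have hp : ∀ t ∈ Set.Icc 0 l, p t = 0 := fun t ht =>
    (uniqueDiffOn_Icc hl t ht).eq_deriv _ (h.hasDeriv t ht)
      ((hasDerivWithinAt_const t _ (0 : ℂ)).congr hy (hy ht))
  have hint : ∀ t ∈ Set.Icc 0 l, ∫ s in (0 : ℝ)..t, g s = 0 := fun t ht => by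
    have := h.deriv_eq t ht
    rw [hp t ht, hp 0 ⟨le_rfl, hl.le⟩] at this
    simpa using this.symm
  have hg : g =ᵐ[volume.restrict (Set.Icc 0 l)] 0 := by
    have hd := (h.intervalIntegrable ⟨hl.le, le_rfl⟩).ae_hasDerivAt_integral
    rw [← restrict_Ioo_eq_restrict_Icc]
    refine (ae_restrict_iff' measurableSet_Ioo).2 ?_
    filter_upwards [hd] with t ht hmem
    rw [Set.uIcc_of_le hl.le] at ht
    refine (ht ⟨hmem.1.le, hmem.2.le⟩ 0 ⟨le_rfl, hl.le⟩).unique ?_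
    refine (hasDerivAt_const t (0 : ℂ)).congr_of_eventuallyEq ?_
    filter_upwards [Ioo_mem_nhds hmem.1 hmem.2] with x hx
    exact hint x ⟨hx.1.le, hx.2.le⟩
  refine Lp.ext ?_
  filter_upwards [hv, hy0, hg, Lp.coeFn_zero ℂ 2 (volume.restrict (Set.Icc (0 : ℝ) l))]
    with t h1 h2 h3 h4
  rw [h4]
  simpa [h2, h3] using h1

theorem dirichletOp_graph {l : ℝ} (hl : 0 < l) (V : ℝ → ℝ) :
    (dirichletOp l V).graph = dirichletGraph l V :=
  Submodule.toLinearPMap_graph_eq _ (dirichletGraph_functional hl V)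

/-- The spectrum of an unbounded operator `A`: the complement of the set of those `z` for which
`A - z : dom A → H` is bijective with bounded inverse `R`. -/
def spec {H : Type*} [NormedAddCommGroup H] [NormedSpace ℂ H] (A : H →ₗ.[ℂ] H) : Set ℂ :=
  {z | ¬ ∃ R : H →L[ℂ] H, ∀ u f : H, (u, f + z • u) ∈ A.graph ↔ u = R f}

/-- `z` is an eigenvalue of the unbounded operator `A`. -/
def IsEigenvalue {H : Type*} [NormedAddCommGroup H] [NormedSpace ℂ H] (A : H →ₗ.[ℂ] H)
    (z : ℂ) : Prop :=
  ∃ u : A.domain, u ≠ 0 ∧ A u = z • (u : H)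

/-- `y ∈ H²[a,b]`, with first derivative `p`, solves `-y'' + W y = z y` on `[a,b]`. -/
def IsSolution (a b : ℝ) (W : ℝ → ℝ) (z : ℂ) (y p : ℝ → ℂ) : Prop :=
  ∃ g : ℝ → ℂ, IsH2 a b y p g ∧
    ∀ᵐ t ∂(volume.restrict (Set.Icc a b)), -g t + (W t : ℂ) * y t = z * y t

/-- `s` is the value at `z` of the Krein function of the boundary triple
`Γ f = (f(0), f(l))`, `Γ' f = (f'(0), -f'(l))` for `S = -d²/dt² + V` on `H²[0,l]`: the boundary
value problem `(S - z) f = 0`, `Γ f = c` is solvable for every `c`, and `Γ' f = s Γ f` for every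
solution `f` of `(S - z) f = 0`. These conditions determine `s`. -/
def IsKreinMatrix (l : ℝ) (V : ℝ → ℝ) (z : ℂ) (s : Matrix (Fin 2) (Fin 2) ℂ) : Prop :=
  (∀ c : Fin 2 → ℂ, ∃ f p : ℝ → ℂ, IsSolution 0 l V z f p ∧ ![f 0, f l] = c) ∧
  ∀ f p : ℝ → ℂ, IsSolution 0 l V z f p → ![p 0, -p l] = s.mulVec ![f 0, f l]

open Classical in
/-- The Krein matrix `s(z)` (the zero matrix at the points where it is not defined). -/
def kreinMatrix (l : ℝ) (V : ℝ → ℝ) (z : ℂ) : Matrix (Fin 2) (Fin 2) ℂ :=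
  if h : ∃ s, IsKreinMatrix l V z s then h.choose else 0

/-- `α / s₁₂(z) - (1 + β²) (s₁₁(z) + s₂₂(z)) / s₁₂(z)`. -/
def kreinEta (l : ℝ) (V : ℝ → ℝ) (α β : ℝ) (z : ℂ) : ℂ :=
  (α : ℂ) / kreinMatrix l V z 0 1 -
    (1 + (β : ℂ) ^ 2) * ((kreinMatrix l V z 0 0 + kreinMatrix l V z 1 1) / kreinMatrix l V z 0 1)

/-- The `l`-periodic extension `W` of `V|_[0,l)`: `W(t + n l) = V(t)` for `t ∈ [0,l)`, `n ∈ ℤ`. -/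
def periodize (l : ℝ) (V : ℝ → ℝ) (t : ℝ) : ℝ := V (l * Int.fract (t / l))

/-- `y` is a solution on the whole line of `(P - z) y = 0` for the Kronig–Penney operator
`P = -d²/dt² + W + a ∑ₖ δ(t - k l)`, and `p k` is its derivative on the `k`-th cell
`[k l, (k+1) l]`; thus `p k (k l) = y'(k l +)` and `p (k-1) (k l) = y'(k l -)`. The values
`y(k l ±)` agree and are `y (k l)`, because `y` is continuous on each closed cell. -/
structure IsKPSolution (l : ℝ) (V : ℝ → ℝ) (a : ℝ) (z : ℂ) (y : ℝ → ℂ) (p : ℤ → ℝ → ℂ) :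
    Prop where
  cell : ∀ k : ℤ, IsSolution (k * l) ((k + 1) * l) (periodize l V) z y (p k)
  jump : ∀ k : ℤ, p k (k * l) = p (k - 1) (k * l) + (a : ℂ) * y (k * l)

/-- `y₁, y₂` are solutions of `(P - z) y = 0` with `y₁(0+) = y₂'(0+) = 0` and
`y₁'(0+) = y₂(0+) = 1`. -/
structure IsFundamentalPair (l : ℝ) (V : ℝ → ℝ) (a : ℝ) (z : ℂ) (y₁ : ℝ → ℂ) (p₁ : ℤ → ℝ → ℂ)
    (y₂ : ℝ → ℂ) (p₂ : ℤ → ℝ → ℂ) : Prop where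
  sol₁ : IsKPSolution l V a z y₁ p₁
  sol₂ : IsKPSolution l V a z y₂ p₂
  val₁ : y₁ 0 = 0
  der₁ : p₁ 0 0 = 1
  val₂ : y₂ 0 = 1
  der₂ : p₂ 0 0 = 0

/-- `M` is the monodromy matrix of `P` at `z`. -/
def IsMonodromy (l : ℝ) (V : ℝ → ℝ) (a : ℝ) (z : ℂ) (M : Matrix (Fin 2) (Fin 2) ℂ) : Prop :=
  (∃ y₁ p₁ y₂ p₂, IsFundamentalPair l V a z y₁ p₁ y₂ p₂) ∧
  ∀ y₁ p₁ y₂ p₂, IsFundamentalPair l V a z y₁ p₁ y₂ p₂ →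
    M = !![p₁ 1 l, p₂ 1 l; y₁ l, y₂ l]

open Classical in
/-- The monodromy matrix `M(z)` of `P` (the zero matrix if it were not defined). -/
def monodromy (l : ℝ) (V : ℝ → ℝ) (a : ℝ) (z : ℂ) : Matrix (Fin 2) (Fin 2) ℂ :=
  if h : ∃ M, IsMonodromy l V a z M then h.choose else 0

/-- The discriminant (Lyapunov function) `tr M(z)` of `P`. -/
def discriminant (l : ℝ) (V : ℝ → ℝ) (a : ℝ) (z : ℂ) : ℂ := (monodromy l V a z).trace

end KreinKP

end

/-!
For `V ∈ L²` the initial value problem for `-y'' + V y = z y` is an integral equation of Volterra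
type, so its solutions form a two-dimensional space and are entire in `z`. Let `c`, `s` be the
solutions with initial values `(1, 0)` and `(0, 1)`. The Wronskian identity turns the Krein matrix
into `s₁₁ = -c(l)/s(l)`, `s₁₂ = 1/s(l)`, `s₂₂ = -s'(l)/s(l)`, whence
`η = α s(l) + (1 + β²) (c(l) + s'(l))`, and this is `1 + β²` times the trace of the matrix that
transports `(y', y)` across one cell followed by the jump at its end. The eigenvalues of `D` are the
zeros of `z ↦ s(z, l)`, which are real, simple and bounded below; there are infinitely many since
`k s(k², l) = sin(k l) + o(1)` as `k → ∞`. At such a zero `c(l) s'(l) = 1`, so `|c(l) + s'(l)| ≥ 2`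
with the sign of `s'(l)`, and this sign alternates because the `z`-derivative of `s(z, l)` has the
sign of `s'(l)` there.

If `η(z)` is real and `|η(z)| ≤ 2 (1 + β²)`, the transfer matrix has an eigenvalue of modulus one,
and the corresponding quasi-periodic boundary condition is self-adjoint, so `z` is real. At a real
critical point the entire function `η` behaves like `η(x) + g (w - x)ᵐ` with `m ≥ 2`, hence takes
nearby real values at nonreal points; the forbidden kinds of critical point would put such values
into the band.
-/

noncomputable section

namespace KreinKP

open Set Filter Topology

section Volterra

variable {𝕜 E : Type*} [NontriviallyNormedField 𝕜] [NormedAddCommGroup E] [NormedSpace 𝕜 E]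
  [NormedSpace ℝ E] [SMulCommClass ℝ 𝕜 E] {a b : ℝ} (hab : a ≤ b)

/-- The Volterra operator `f ↦ ∫ₐᵗ K(s) f(s) ds` on `C([a,b], E)`, as a linear function of the
kernel `K`. -/
def volterra : C(Icc a b, E →L[𝕜] E) →L[𝕜] C(Icc a b, E) →L[𝕜] C(Icc a b, E) :=
  LinearMap.mkContinuous₂
    (LinearMap.mk₂ 𝕜
      (fun K f => ⟨fun t : Icc a b => ∫ s in a..t, IccExtend hab (fun s => K s (f s)) s,
        (intervalIntegral.continuous_primitive (fun _ _ =>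
          (K.continuous.clm_apply f.continuous).Icc_extend'.intervalIntegrable _ _) a).comp
            continuous_subtype_val⟩)
      (fun K K' f => by
        ext t
        exact intervalIntegral.integral_add
          ((K.continuous.clm_apply f.continuous).Icc_extend'.intervalIntegrable _ _)
          ((K'.continuous.clm_apply f.continuous).Icc_extend'.intervalIntegrable _ _))
      (fun c K f => by
        ext t
        exact intervalIntegral.integral_smul c _)
      (fun K f f' => by
        ext t
        simp only [ContinuousMap.coe_mk, ContinuousMap.add_apply, map_add]
        exact intervalIntegral.integral_add
          ((K.continuous.clm_apply f.continuous).Icc_extend'.intervalIntegrable _ _)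
          ((K.continuous.clm_apply f'.continuous).Icc_extend'.intervalIntegrable _ _))
      (fun c K f => by
        ext t
        simp only [ContinuousMap.coe_mk, ContinuousMap.smul_apply, map_smul]
        exact intervalIntegral.integral_smul c _))
    (b - a) (fun K f => by
      have := sub_nonneg.2 hab
      refine (ContinuousMap.norm_le _ (by positivity)).2 fun t => ?_
      have hbound : ∀ s, ‖IccExtend hab (fun s => K s (f s)) s‖ ≤ ‖K‖ * ‖f‖ := fun s =>
        (K _).le_of_opNorm_le_of_le (K.norm_coe_le_norm _) (f.norm_coe_le_norm _)
      refine (intervalIntegral.norm_integral_le_of_norm_le_const fun s _ => hbound s).trans ?_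
      rw [abs_of_nonneg (sub_nonneg.2 t.2.1), mul_comm, ← mul_assoc]
      gcongr
      exact t.2.2)

theorem volterra_apply (K : C(Icc a b, E →L[𝕜] E)) (f : C(Icc a b, E)) (t : Icc a b) :
    volterra hab K f t = ∫ s in a..t, IccExtend hab (fun s => K s (f s)) s := rfl

theorem norm_volterra_pow_apply_le (K : C(Icc a b, E →L[𝕜] E)) (f : C(Icc a b, E)) (n : ℕ)
    (t : Icc a b) :
    ‖(volterra hab K ^ n) f t‖ ≤ ‖K‖ ^ n * (t - a) ^ n / n.factorial * ‖f‖ := by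
  induction n generalizing t with
  | zero => simpa using f.norm_coe_le_norm t
  | succ n ih =>
    rw [pow_succ', mul_apply_eq_comp, volterra_apply]
    have hbound : ∀ s ∈ Ioc a (t : ℝ),
        ‖IccExtend hab (fun s => K s ((volterra hab K ^ n) f s)) s‖ ≤
          ‖K‖ ^ (n + 1) / n.factorial * ‖f‖ * (s - a) ^ n := by
      intro s hs
      have hs' : s ∈ Icc a b := ⟨hs.1.le, hs.2.trans t.2.2⟩
      rw [IccExtend_of_mem _ _ hs']
      refine ((K _).le_of_opNorm_le_of_le (K.norm_coe_le_norm _) (ih ⟨s, hs'⟩)).trans_eq ?_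
      ring
    refine (intervalIntegral.norm_integral_le_of_norm_le t.2.1 (ae_of_all _ hbound)
      ((by fun_prop : Continuous _).intervalIntegrable _ _)).trans_eq ?_
    rw [intervalIntegral.integral_const_mul,
      intervalIntegral.integral_comp_sub_right (fun s => s ^ n), sub_self, integral_pow,
      zero_pow n.succ_ne_zero, sub_zero, Nat.factorial_succ]
    push_cast
    field_simp

theorem isUnit_one_sub_volterra [CompleteSpace E] (K : C(Icc a b, E →L[𝕜] E)) :
    IsUnit (1 - volterra hab K) := by
  obtain ⟨n, hn⟩ := ((FloorSemiring.tendsto_pow_div_factorial_atTop (‖K‖ * (b - a))).eventually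
    (gt_mem_nhds zero_lt_one)).exists
  have := sub_nonneg.2 hab
  have hnorm : ‖volterra hab K ^ n‖ < 1 := by
    refine (ContinuousLinearMap.opNorm_le_bound _ (by positivity) fun f => ?_).trans_lt hn
    refine (ContinuousMap.norm_le _ (by positivity)).2 fun t => ?_
    refine (norm_volterra_pow_apply_le hab K f n t).trans ?_
    have hta : 0 ≤ (t : ℝ) - a := sub_nonneg.2 t.2.1
    rw [← mul_pow]
    gcongr
    exact t.2.2
  have hunit : IsUnit (1 - volterra hab K ^ n) :=
    isUnit_one_sub_of_norm_lt_one (R := C(Icc a b, E) →L[𝕜] C(Icc a b, E)) hnorm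
  have hcomm : Commute (1 - volterra hab K) (∑ i ∈ Finset.range n, volterra hab K ^ i) :=
    (Commute.one_left _).sub_left
      (Commute.sum_right _ _ _ fun i _ => (Commute.refl _).pow_right i)
  rw [← mul_neg_geom_sum] at hunit
  exact (hcomm.isUnit_mul_iff.1 hunit).1

/-- The solution of `Y = v + ∫ₐᵗ K Y` in `C([a,b], E)`. -/
def volterraSol (K : C(Icc a b, E →L[𝕜] E)) (v : E) : C(Icc a b, E) :=
  Ring.inverse (1 - volterra hab K) (ContinuousMap.const _ v)

variable [CompleteSpace E]

theorem volterraSol_apply (K : C(Icc a b, E →L[𝕜] E)) (v : E) (t : Icc a b) :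
    volterraSol hab K v t =
      v + ∫ s in a..t, IccExtend hab (fun s => K s (volterraSol hab K v s)) s := by
  have h := congrArg (fun A => A (ContinuousMap.const (Icc a b) v) t)
    (Ring.mul_inverse_cancel _ (isUnit_one_sub_volterra hab K))
  simp only [mul_apply_eq_comp, one_apply_eq_self, sub_apply] at h
  exact sub_eq_iff_eq_add.1 h

theorem volterraSol_left (K : C(Icc a b, E →L[𝕜] E)) (v : E) :
    volterraSol hab K v ⟨a, left_mem_Icc.2 hab⟩ = v := by
  simp [volterraSol_apply hab K v ⟨a, _⟩]

theorem hasDerivWithinAt_volterraSol (K : C(Icc a b, E →L[𝕜] E)) (v : E) (t : Icc a b) :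
    HasDerivWithinAt (IccExtend hab (volterraSol hab K v)) (K t (volterraSol hab K v t))
      (Icc a b) t := by
  have hc : Continuous (IccExtend hab fun s => K s (volterraSol hab K v s)) :=
    (K.continuous.clm_apply (volterraSol hab K v).continuous).Icc_extend'
  have h := ((hc.integral_hasStrictDerivAt a t).hasDerivAt.const_add v).hasDerivWithinAt
    (s := Icc a b)
  rw [IccExtend_val] at h
  refine h.congr_of_mem (fun s hs => ?_) t.2
  rw [IccExtend_of_mem _ _ hs, volterraSol_apply]

theorem differentiable_volterraSol_sub_smul (K N : C(Icc a b, E →L[𝕜] E)) (v : E) :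
    Differentiable 𝕜 fun z : 𝕜 => volterraSol hab (K - z • N) v := by
  intro z
  have hunit := isUnit_one_sub_volterra hab (K - z • N)
  simp only [volterraSol, map_sub, map_smul] at hunit ⊢
  exact (DifferentiableAt.inverse (by fun_prop) hunit).clm_apply (differentiableAt_const _)

theorem differentiable_IccExtend_volterraSol_sub_smul (K N : C(Icc a b, E →L[𝕜] E)) (v : E)
    (t : ℝ) : Differentiable 𝕜 fun z : 𝕜 => IccExtend hab (volterraSol hab (K - z • N) v) t :=
  (ContinuousMap.evalCLM (M := E) 𝕜 (projIcc a b hab t)).differentiable.comp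
    (differentiable_volterraSol_sub_smul hab K N v)

theorem continuous_IccExtend_volterraSol_sub_smul (K N : C(Icc a b, E →L[𝕜] E)) (v : E) :
    Continuous fun x : 𝕜 × ℝ => IccExtend hab (volterraSol hab (K - x.1 • N) v) x.2 :=
  ((differentiable_volterraSol_sub_smul hab K N v).continuous.comp continuous_fst).eval
    (continuous_projIcc.comp continuous_snd)

end Volterra

theorem eqOn_Icc_of_hasDerivWithinAt_clm {𝕜 E : Type*} [NontriviallyNormedField 𝕜]
    [NormedAddCommGroup E] [NormedSpace 𝕜 E] [NormedSpace ℝ E] {a b : ℝ}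
    (K : C(Icc a b, E →L[𝕜] E)) {Y Z : ℝ → E}
    (hY : ∀ t : Icc a b, HasDerivWithinAt Y (K t (Y t)) (Icc a b) t)
    (hZ : ∀ t : Icc a b, HasDerivWithinAt Z (K t (Z t)) (Icc a b) t) (h : Y a = Z a) :
    EqOn Y Z (Icc a b) := by
  intro t ht
  have hab : a ≤ b := ht.1.trans ht.2
  have hderiv : ∀ {X : ℝ → E}, (∀ t : Icc a b, HasDerivWithinAt X (K t (X t)) (Icc a b) t) →
      ∀ s ∈ Ico a b, HasDerivWithinAt X (IccExtend hab K s (X s)) (Ici s) s := fun hX s hs => by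
    rw [IccExtend_of_mem _ _ (Ico_subset_Icc_self hs)]
    exact (hX ⟨s, Ico_subset_Icc_self hs⟩).mono_of_mem_nhdsWithin (Icc_mem_nhdsGE_of_mem hs)
  refine ODE_solution_unique_of_mem_Icc_right (v := fun s x => IccExtend hab (⇑K) s x)
    (s := fun _ => univ) (K := ‖K‖₊) (fun s _ => ?_)
    (fun s hs => (hY ⟨s, hs⟩).continuousWithinAt) (hderiv hY) (fun _ _ => mem_univ _)
    (fun s hs => (hZ ⟨s, hs⟩).continuousWithinAt) (hderiv hZ) (fun _ _ => mem_univ _) h ht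
  exact ((K _).lipschitz.weaken (K.norm_coe_le_norm _)).lipschitzOnWith

section Primitive

theorem absolutelyContinuousOnInterval_of_dist_le {X Y : Type*} [PseudoMetricSpace X]
    [PseudoMetricSpace Y] {F : ℝ → X} {G : ℝ → Y} {a b : ℝ}
    (hG : AbsolutelyContinuousOnInterval G a b)
    (h : ∀ s ∈ uIcc a b, ∀ t ∈ uIcc a b, dist (F s) (F t) ≤ dist (G s) (G t)) :
    AbsolutelyContinuousOnInterval F a b := by
  refine squeeze_zero' (Eventually.of_forall fun _ => Finset.sum_nonneg fun _ _ => dist_nonneg)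
    ?_ hG
  rw [eventually_inf_principal]
  exact Eventually.of_forall fun I hI => Finset.sum_le_sum fun i hi =>
    h _ (hI.1 i hi).1 _ (hI.1 i hi).2

variable {E : Type*} [NormedAddCommGroup E] [NormedSpace ℝ E] {a b : ℝ} {F G f g : ℝ → E}

/-- On `[a,b]`, the function `F` is an indefinite integral of the integrable function `f`. -/
structure IsPrimitiveOn (a b : ℝ) (F f : ℝ → E) : Prop where
  intervalIntegrable : IntervalIntegrable f volume a b
  eq_add_integral : ∀ t ∈ Icc a b, F t = F a + ∫ s in a..t, f s

namespace IsPrimitiveOn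

theorem intervalIntegrable_of_mem (h : IsPrimitiveOn a b F f) {s t : ℝ} (hs : s ∈ Icc a b)
    (ht : t ∈ Icc a b) : IntervalIntegrable f volume s t :=
  h.intervalIntegrable.mono_set (uIcc_subset_uIcc (Icc_subset_uIcc hs) (Icc_subset_uIcc ht))

theorem sub_eq_integral (h : IsPrimitiveOn a b F f) {s t : ℝ} (hs : s ∈ Icc a b)
    (ht : t ∈ Icc a b) : F t - F s = ∫ r in s..t, f r := by
  have ha : a ∈ Icc a b := left_mem_Icc.2 (hs.1.trans hs.2)
  rw [h.eq_add_integral t ht, h.eq_add_integral s hs, add_sub_add_left_eq_sub,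
    intervalIntegral.integral_interval_sub_left (h.intervalIntegrable_of_mem ha ht)
      (h.intervalIntegrable_of_mem ha hs)]

theorem absolutelyContinuousOnInterval (hab : a ≤ b) (h : IsPrimitiveOn a b F f) :
    AbsolutelyContinuousOnInterval F a b := by
  have hnorm := h.intervalIntegrable.norm
  refine absolutelyContinuousOnInterval_of_dist_le
    (hnorm.absolutelyContinuousOnInterval_intervalIntegral (c := a) left_mem_uIcc)
    fun s hs t ht => ?_
  have hsub : ∀ r ∈ uIcc a b, IntervalIntegrable (fun x => ‖f x‖) volume a r := fun r hr =>
    hnorm.mono_set (uIcc_subset_uIcc_left hr)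
  have hs' : s ∈ Icc a b := uIcc_of_le hab ▸ hs
  have ht' : t ∈ Icc a b := uIcc_of_le hab ▸ ht
  rw [dist_eq_norm, dist_eq_norm, h.sub_eq_integral ht' hs', Real.norm_eq_abs,
    intervalIntegral.integral_interval_sub_left (hsub s hs) (hsub t ht)]
  exact intervalIntegral.norm_integral_le_abs_integral_norm

theorem continuousOn (hab : a ≤ b) (h : IsPrimitiveOn a b F f) : ContinuousOn F (Icc a b) :=
  uIcc_of_le hab ▸ (h.absolutelyContinuousOnInterval hab).continuousOn

theorem congr_ae (hab : a ≤ b) (h : IsPrimitiveOn a b F f)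
    (hfg : f =ᵐ[volume.restrict (Icc a b)] g) : IsPrimitiveOn a b F g where
  intervalIntegrable := h.intervalIntegrable.congr_ae
    (ae_restrict_of_ae_restrict_of_subset (uIoc_of_le hab ▸ Ioc_subset_Icc_self) hfg)
  eq_add_integral t ht := by
    rw [h.eq_add_integral t ht]
    refine congrArg (F a + ·) (intervalIntegral.integral_congr_ae_restrict
      (ae_restrict_of_ae_restrict_of_subset ?_ hfg))
    rw [uIoc_of_le ht.1]
    exact Ioc_subset_Icc_self.trans (Icc_subset_Icc_right ht.2)

theorem congr (hab : a ≤ b) (h : IsPrimitiveOn a b F f) (hfg : EqOn f g (Icc a b)) :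
    IsPrimitiveOn a b F g :=
  h.congr_ae hab (ae_restrict_of_forall_mem measurableSet_Icc hfg)

theorem add (hF : IsPrimitiveOn a b F f) (hG : IsPrimitiveOn a b G g) :
    IsPrimitiveOn a b (fun t => F t + G t) (fun t => f t + g t) where
  intervalIntegrable := hF.intervalIntegrable.add hG.intervalIntegrable
  eq_add_integral t ht := by
    have ha : a ∈ Icc a b := left_mem_Icc.2 (ht.1.trans ht.2)
    rw [intervalIntegral.integral_add (hF.intervalIntegrable_of_mem ha ht)
      (hG.intervalIntegrable_of_mem ha ht), hF.eq_add_integral t ht, hG.eq_add_integral t ht]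
    abel

theorem sub (hF : IsPrimitiveOn a b F f) (hG : IsPrimitiveOn a b G g) :
    IsPrimitiveOn a b (fun t => F t - G t) (fun t => f t - g t) where
  intervalIntegrable := hF.intervalIntegrable.sub hG.intervalIntegrable
  eq_add_integral t ht := by
    have ha : a ∈ Icc a b := left_mem_Icc.2 (ht.1.trans ht.2)
    rw [intervalIntegral.integral_sub (hF.intervalIntegrable_of_mem ha ht)
      (hG.intervalIntegrable_of_mem ha ht), hF.eq_add_integral t ht, hG.eq_add_integral t ht]
    abel

variable [CompleteSpace E]

theorem ae_hasDerivAt (hab : a ≤ b) (h : IsPrimitiveOn a b F f) :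
    ∀ᵐ t, t ∈ uIcc a b → HasDerivAt F (f t) t := by
  filter_upwards [h.intervalIntegrable.ae_hasDerivAt_integral, Measure.ae_ne volume a,
    Measure.ae_ne volume b] with t hderiv hta htb ht
  rw [uIcc_of_le hab] at ht
  refine ((hderiv (Icc_subset_uIcc ht) a left_mem_uIcc).const_add (F a)).congr_of_eventuallyEq ?_
  filter_upwards [Icc_mem_nhds (ht.1.lt_of_ne' hta) (ht.2.lt_of_ne htb)] with s hs
  exact h.eq_add_integral s hs

theorem of_hasDerivWithinAt (hab : a ≤ b) (hf : ContinuousOn f (Icc a b))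
    (h : ∀ t ∈ Icc a b, HasDerivWithinAt F (f t) (Icc a b) t) : IsPrimitiveOn a b F f where
  intervalIntegrable := hf.intervalIntegrable_of_Icc hab
  eq_add_integral t ht := by
    have hsub : Icc a t ⊆ Icc a b := Icc_subset_Icc_right ht.2
    rw [intervalIntegral.integral_eq_sub_of_hasDerivAt_of_le ht.1
      (fun s hs => (h s (hsub hs)).continuousWithinAt.mono hsub)
      (fun s hs => (h s (hsub (Ioo_subset_Icc_self hs))).hasDerivAt
        (Icc_mem_nhds hs.1 (hs.2.trans_le ht.2)))
      ((hf.mono hsub).intervalIntegrable_of_Icc ht.1), add_sub_cancel]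

theorem hasDerivWithinAt (h : IsPrimitiveOn a b F f) (hf : ContinuousOn f (Icc a b)) {t : ℝ}
    (ht : t ∈ Icc a b) : HasDerivWithinAt F (f t) (Icc a b) t := by
  have : Fact (t ∈ Icc a b) := ⟨ht⟩
  have hderiv := intervalIntegral.integral_hasDerivWithinAt_right
    (h.intervalIntegrable_of_mem (left_mem_Icc.2 (ht.1.trans ht.2)) ht) (s := Icc a b)
    (hf.stronglyMeasurableAtFilter_nhdsWithin measurableSet_Icc t) (hf t ht)
  exact (hderiv.const_add (F a)).congr_of_mem h.eq_add_integral ht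

theorem smul {𝕜 : Type*} [RCLike 𝕜] [NormedSpace 𝕜 E] [IsScalarTower ℝ 𝕜 E]
    {Q q : ℝ → 𝕜} (hab : a ≤ b) (hQ : IsPrimitiveOn a b Q q) (hF : IsPrimitiveOn a b F f) :
    IsPrimitiveOn a b (fun t => Q t • F t) (fun t => q t • F t + Q t • f t) := by
  have hφ : IntervalIntegrable (fun t => q t • F t + Q t • f t) volume a b :=
    (hQ.intervalIntegrable.smul_continuousOn (uIcc_of_le hab ▸ hF.continuousOn hab)).add
      (hF.intervalIntegrable.continuousOn_smul (uIcc_of_le hab ▸ hQ.continuousOn hab))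
  have hΦ : IsPrimitiveOn a b (fun t => ∫ s in a..t, (q s • F s + Q s • f s))
    (fun t => q t • F t + Q t • f t) := ⟨hφ, by simp⟩
  obtain ⟨C, hC⟩ := (((hQ.absolutelyContinuousOnInterval hab).fun_smul
    (hF.absolutelyContinuousOnInterval hab)).fun_sub
    (hΦ.absolutelyContinuousOnInterval hab)).const_of_ae_hasDerivAt_zero (by
      filter_upwards [hQ.ae_hasDerivAt hab, hF.ae_hasDerivAt hab, hΦ.ae_hasDerivAt hab]
        with t h₁ h₂ h₃ ht
      refine (((h₁ ht).smul (h₂ ht)).sub (h₃ ht)).congr_deriv ?_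
      abel)
  refine ⟨hφ, fun t ht => ?_⟩
  have ha := hC a left_mem_uIcc
  have ht := hC t (Icc_subset_uIcc ht)
  rw [← ha, intervalIntegral.integral_same, sub_zero] at ht
  exact sub_eq_iff_eq_add.1 ht

end IsPrimitiveOn

end Primitive

section RegularizedSystem

variable {𝕜 : Type*} [RCLike 𝕜] {a b : ℝ} {Q q V w : ℝ → ℝ}

/-- The first-order system `y' = Q y + u`, `u' = -Q u + q y - z y` on `[a,b]`. For `Q' = V - w` and
`q = w - Q²` it is equivalent to `-y'' + V y = z y` through `u = y' - Q y`, but its coefficients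
are continuous. -/
structure IsRegularizedSystem (a b : ℝ) (Q q : ℝ → ℝ) (z : 𝕜) (y u : ℝ → 𝕜) : Prop where
  deriv_fst : ∀ t ∈ Icc a b, HasDerivWithinAt y (Q t • y t + u t) (Icc a b) t
  deriv_snd : ∀ t ∈ Icc a b, HasDerivWithinAt u (-(Q t • u t) + q t • y t - z * y t) (Icc a b) t

namespace IsRegularizedSystem

theorem continuousOn_fst {z : 𝕜} {y u : ℝ → 𝕜} (h : IsRegularizedSystem a b Q q z y u) :
    ContinuousOn y (Icc a b) := fun t ht => (h.deriv_fst t ht).continuousWithinAt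

theorem continuousOn_snd {z : 𝕜} {y u : ℝ → 𝕜} (h : IsRegularizedSystem a b Q q z y u) :
    ContinuousOn u (Icc a b) := fun t ht => (h.deriv_snd t ht).continuousWithinAt

theorem re {x : ℝ} {y u : ℝ → ℂ} (h : IsRegularizedSystem a b Q q (x : ℂ) y u) :
    IsRegularizedSystem a b Q q x (fun t => (y t).re) (fun t => (u t).re) where
  deriv_fst t ht :=
    (Complex.reCLM.hasFDerivAt.comp_hasDerivWithinAt t (h.deriv_fst t ht)).congr_deriv (by simp)
  deriv_snd t ht :=
    (Complex.reCLM.hasFDerivAt.comp_hasDerivWithinAt t (h.deriv_snd t ht)).congr_deriv (by simp)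

end IsRegularizedSystem

/-- The coefficient matrix of the regularized system with spectral parameter `0`. -/
def regularizedCoeff (Q q : C(Icc a b, ℝ)) : C(Icc a b, (ℂ × ℂ) →L[ℂ] ℂ × ℂ) where
  toFun t :=
    (Q t : ℂ) • (ContinuousLinearMap.fst ℂ ℂ ℂ).prod (-ContinuousLinearMap.snd ℂ ℂ ℂ) +
      (q t : ℂ) • (0 : (ℂ × ℂ) →L[ℂ] ℂ).prod (ContinuousLinearMap.fst ℂ ℂ ℂ) +
      (ContinuousLinearMap.snd ℂ ℂ ℂ).prod 0
  continuous_toFun := by fun_prop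

/-- Minus the derivative of the coefficient matrix of the regularized system in the spectral
parameter. -/
def spectralCoeff (a b : ℝ) : C(Icc a b, (ℂ × ℂ) →L[ℂ] ℂ × ℂ) :=
  .const _ ((0 : (ℂ × ℂ) →L[ℂ] ℂ).prod (ContinuousLinearMap.fst ℂ ℂ ℂ))

theorem regularizedCoeff_sub_smul_apply (Q q : C(Icc a b, ℝ)) (z : ℂ) (t : Icc a b) (v : ℂ × ℂ) :
    (regularizedCoeff Q q - z • spectralCoeff a b) t v =
      (Q t • v.1 + v.2, -(Q t • v.2) + q t • v.1 - z * v.1) := by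
  ext <;> simp [regularizedCoeff, spectralCoeff]

theorem isRegularizedSystem_iff (hQ : ContinuousOn Q (Icc a b)) (hq : ContinuousOn q (Icc a b))
    {z : ℂ} {y u : ℝ → ℂ} :
    IsRegularizedSystem a b Q q z y u ↔ ∀ t : Icc a b, HasDerivWithinAt (fun t => (y t, u t))
      ((regularizedCoeff ⟨_, hQ.domRestrict⟩ ⟨_, hq.domRestrict⟩ - z • spectralCoeff a b) t
        (y t, u t)) (Icc a b) t := by
  simp only [regularizedCoeff_sub_smul_apply]
  exact ⟨fun h t => (h.deriv_fst t t.2).prodMk (h.deriv_snd t t.2),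
    fun h => ⟨fun t ht => (h ⟨t, ht⟩).fst, fun t ht => (h ⟨t, ht⟩).snd⟩⟩

theorem IsRegularizedSystem.eqOn (hQ : ContinuousOn Q (Icc a b)) (hq : ContinuousOn q (Icc a b))
    {z : ℂ} {y u y' u' : ℝ → ℂ} (h : IsRegularizedSystem a b Q q z y u)
    (h' : IsRegularizedSystem a b Q q z y' u') (hy : y a = y' a) (hu : u a = u' a) :
    EqOn y y' (Icc a b) ∧ EqOn u u' (Icc a b) := by
  have heq := eqOn_Icc_of_hasDerivWithinAt_clm _ ((isRegularizedSystem_iff hQ hq).1 h)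
    ((isRegularizedSystem_iff hQ hq).1 h') (Prod.ext hy hu)
  exact ⟨fun t ht => congrArg Prod.fst (heq ht), fun t ht => congrArg Prod.snd (heq ht)⟩

theorem exists_isRegularizedSystem (hab : a ≤ b) (hQ : ContinuousOn Q (Icc a b))
    (hq : ContinuousOn q (Icc a b)) (v : ℂ × ℂ) :
    ∃ y u : ℂ → ℝ → ℂ,
      (∀ z, IsRegularizedSystem a b Q q z (y z) (u z) ∧ y z a = v.1 ∧ u z a = v.2) ∧
      (∀ t, Differentiable ℂ (y · t) ∧ Differentiable ℂ (u · t)) ∧ Continuous y.uncurry := by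
  let K := regularizedCoeff ⟨_, hQ.domRestrict⟩ ⟨_, hq.domRestrict⟩
  have hY := differentiable_IccExtend_volterraSol_sub_smul hab K (spectralCoeff a b) v
  refine ⟨fun z t => (IccExtend hab (volterraSol hab (K - z • spectralCoeff a b) v) t).1,
    fun z t => (IccExtend hab (volterraSol hab (K - z • spectralCoeff a b) v) t).2,
    fun z => ⟨(isRegularizedSystem_iff hQ hq).2 fun t => ?_, ?_⟩,
    fun t => ⟨(hY t).fst, (hY t).snd⟩,
    (continuous_IccExtend_volterraSol_sub_smul hab K (spectralCoeff a b) v).fst⟩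
  · simpa only [Prod.mk.eta, IccExtend_val] using hasDerivWithinAt_volterraSol hab _ v t
  · simp only [IccExtend_left, volterraSol_left, and_self]

end RegularizedSystem

section Solutions

variable {a b : ℝ} {V Q w : ℝ → ℝ} {z : ℂ} {y p : ℝ → ℂ}

theorem memLp_smul_of_continuousOn (hV : MemLp V 2 (volume.restrict (Icc a b)))
    (hy : ContinuousOn y (Icc a b)) :
    MemLp (fun t => V t • y t) 2 (volume.restrict (Icc a b)) := by
  obtain ⟨C, hC⟩ := isCompact_Icc.exists_bound_of_continuousOn hy
  refine hV.of_le_mul (c := C)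
    (hV.aestronglyMeasurable.smul (hy.aestronglyMeasurable measurableSet_Icc)) ?_
  filter_upwards [ae_restrict_mem measurableSet_Icc] with t ht
  rw [norm_smul, mul_comm]
  exact mul_le_mul_of_nonneg_right (hC t ht) (norm_nonneg _)

theorem isSolution_iff_isPrimitiveOn (hab : a ≤ b)
    (hV : MemLp V 2 (volume.restrict (Icc a b))) :
    IsSolution a b V z y p ↔ (∀ t ∈ Icc a b, HasDerivWithinAt y (p t) (Icc a b) t) ∧
      IsPrimitiveOn a b p (fun t => V t • y t - z * y t) := by
  refine ⟨fun ⟨g, hg, hae⟩ => ⟨hg.hasDeriv, ?_⟩, fun ⟨hy, hp⟩ => ?_⟩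
  · have hpg : IsPrimitiveOn a b p g :=
      ⟨hg.intervalIntegrable (right_mem_Icc.2 hab), hg.deriv_eq⟩
    refine hpg.congr_ae hab ?_
    filter_upwards [hae] with t ht
    rw [Complex.real_smul, ← ht]
    ring
  · have hyc : ContinuousOn y (Icc a b) := fun t ht => (hy t ht).continuousWithinAt
    have hyL : MemLp y 2 (volume.restrict (Icc a b)) := by
      simpa using memLp_smul_of_continuousOn (memLp_const 1) hyc
    refine ⟨_, ⟨(memLp_smul_of_continuousOn hV hyc).sub (hyL.const_mul z), hy,
      hp.eq_add_integral⟩, ae_of_all _ fun t => ?_⟩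
    simp only [Pi.sub_apply, Complex.real_smul]
    ring

/-- A decomposition `V = Q' + w` on `[a,b]` with `Q` absolutely continuous and `w` continuous. It
turns `-y'' + V y = z y` into a first-order system with continuous coefficients. -/
structure IsRegularization (a b : ℝ) (V Q w : ℝ → ℝ) : Prop where
  isPrimitiveOn : IsPrimitiveOn a b Q (fun t => V t - w t)
  continuousOn : ContinuousOn w (Icc a b)

theorem exists_isRegularization (hab : a ≤ b) (hV : IntegrableOn V (Icc a b)) {ε : ℝ}
    (hε : 0 < ε) : ∃ Q w, IsRegularization a b V Q w ∧ ∀ t ∈ Icc a b, |Q t| ≤ ε := by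
  obtain ⟨w, hw, hwi⟩ := hV.exists_boundedContinuous_integral_sub_le hε
  have hVw : IntervalIntegrable (fun t => V t - w t) volume a b :=
    (intervalIntegrable_iff_integrableOn_Icc_of_le hab).2 (hV.sub hwi)
  refine ⟨fun t => ∫ s in a..t, (V s - w s), w, ⟨⟨hVw, by simp⟩, w.continuous.continuousOn⟩,
    fun t ht => ?_⟩
  rw [← Real.norm_eq_abs]
  refine (intervalIntegral.norm_integral_le_integral_norm ht.1).trans (le_trans ?_ hw)
  rw [intervalIntegral.integral_of_le ht.1]
  exact setIntegral_mono_set (hV.sub hwi).norm (ae_of_all _ fun _ => norm_nonneg _)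
    (Ioc_subset_Icc_self.trans (Icc_subset_Icc_right ht.2)).eventuallyLE

theorem IsRegularization.isSolution_iff (hab : a ≤ b)
    (hV : MemLp V 2 (volume.restrict (Icc a b))) (h : IsRegularization a b V Q w) :
    IsSolution a b V z y p ↔
      IsRegularizedSystem a b Q (fun t => w t - Q t ^ 2) z y (fun t => p t - Q t • y t) := by
  have hQ := h.isPrimitiveOn.continuousOn hab
  have hQy (hpc : ContinuousOn p (Icc a b))
      (hy : ∀ t ∈ Icc a b, HasDerivWithinAt y (p t) (Icc a b) t) :
      IsPrimitiveOn a b (fun t => Q t • y t) (fun t => (V t - w t) • y t + Q t • p t) :=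
    h.isPrimitiveOn.smul hab (.of_hasDerivWithinAt hab hpc hy)
  rw [isSolution_iff_isPrimitiveOn hab hV]
  constructor
  · rintro ⟨hy, hp⟩
    have hyc : ContinuousOn y (Icc a b) := fun t ht => (hy t ht).continuousWithinAt
    have hpc := hp.continuousOn hab
    have hu : IsPrimitiveOn a b (fun t => p t - Q t • y t)
        (fun t => w t • y t - z * y t - Q t • p t) :=
      (hp.sub (hQy hpc hy)).congr hab fun t _ => by module
    refine ⟨fun t ht => (hy t ht).congr_deriv (by module), fun t ht =>
      (hu.hasDerivWithinAt ?_ ht).congr_deriv (by module)⟩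
    exact ((h.continuousOn.smul hyc).sub (continuousOn_const.mul hyc)).sub (hQ.smul hpc)
  · intro hs
    have hyc := hs.continuousOn_fst
    have hpc : ContinuousOn p (Icc a b) := by
      simpa only [sub_add_cancel] using hs.continuousOn_snd.fun_add (hQ.fun_smul hyc)
    have hy : ∀ t ∈ Icc a b, HasDerivWithinAt y (p t) (Icc a b) t := fun t ht =>
      (hs.deriv_fst t ht).congr_deriv (by module)
    have hu := IsPrimitiveOn.of_hasDerivWithinAt hab (by
      have := hs.continuousOn_snd
      have := h.continuousOn
      fun_prop) hs.deriv_snd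
    refine ⟨hy, ?_⟩
    simpa only [sub_add_cancel] using
      (hu.add (hQy hpc hy)).congr hab fun t _ => by module

namespace IsSolution

theorem hasDerivWithinAt (h : IsSolution a b V z y p) {t : ℝ} (ht : t ∈ Icc a b) :
    HasDerivWithinAt y (p t) (Icc a b) t :=
  h.choose_spec.1.hasDeriv t ht

theorem continuousOn (h : IsSolution a b V z y p) : ContinuousOn y (Icc a b) := fun _ ht =>
  (h.hasDerivWithinAt ht).continuousWithinAt

theorem add {y' p' : ℝ → ℂ} (h : IsSolution a b V z y p) (h' : IsSolution a b V z y' p') :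
    IsSolution a b V z (y + y') (p + p') := by
  obtain ⟨g, hg, hae⟩ := h
  obtain ⟨g', hg', hae'⟩ := h'
  refine ⟨_, hg.add hg', ?_⟩
  filter_upwards [hae, hae'] with t ht ht'
  simp only [Pi.add_apply]
  linear_combination ht + ht'

theorem smul (c : ℂ) (h : IsSolution a b V z y p) : IsSolution a b V z (c • y) (c • p) := by
  obtain ⟨g, hg, hae⟩ := h
  refine ⟨_, hg.smul c, ?_⟩
  filter_upwards [hae] with t ht
  simp only [Pi.smul_apply, smul_eq_mul]
  linear_combination c * ht

protected theorem star (h : IsSolution a b V z y p) :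
    IsSolution a b V (star z) (star y) (star p) := by
  obtain ⟨g, hg, hae⟩ := h
  refine ⟨star g, ⟨hg.memLp.star, fun t ht => (hg.hasDeriv t ht).star, fun t ht => ?_⟩, ?_⟩
  · exact (congrArg star (hg.deriv_eq t ht)).trans
      ((star_add _ _).trans (congrArg _ intervalIntegral.intervalIntegral_conj.symm))
  · filter_upwards [hae] with t ht
    simpa using congrArg star ht

theorem eqOn (hab : a ≤ b) (hV : MemLp V 2 (volume.restrict (Icc a b))) {y' p' : ℝ → ℂ}
    (h : IsSolution a b V z y p) (h' : IsSolution a b V z y' p') (hy : y a = y' a)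
    (hp : p a = p' a) : EqOn y y' (Icc a b) ∧ EqOn p p' (Icc a b) := by
  obtain ⟨Q, w, hR, -⟩ := exists_isRegularization hab (hV.integrable one_le_two) one_pos
  have hQ := hR.isPrimitiveOn.continuousOn hab
  obtain ⟨heq, heq'⟩ := ((hR.isSolution_iff hab hV).1 h).eqOn hQ (hR.continuousOn.sub (hQ.pow 2))
    ((hR.isSolution_iff hab hV).1 h') hy (by rw [hy, hp])
  exact ⟨heq, fun t ht => by simpa [heq ht] using heq' ht⟩

theorem isPrimitiveOn_wronskian (hab : a ≤ b) (hV : MemLp V 2 (volume.restrict (Icc a b)))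
    {z₁ z₂ : ℂ} {y₁ p₁ y₂ p₂ : ℝ → ℂ} (h₁ : IsSolution a b V z₁ y₁ p₁)
    (h₂ : IsSolution a b V z₂ y₂ p₂) :
    IsPrimitiveOn a b (fun t => y₁ t * p₂ t - p₁ t * y₂ t)
      (fun t => (z₁ - z₂) * (y₁ t * y₂ t)) := by
  obtain ⟨hy₁, hp₁⟩ := (isSolution_iff_isPrimitiveOn hab hV).1 h₁
  obtain ⟨hy₂, hp₂⟩ := (isSolution_iff_isPrimitiveOn hab hV).1 h₂
  have hy₁p₁ := IsPrimitiveOn.of_hasDerivWithinAt hab (hp₁.continuousOn hab) hy₁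
  have hy₂p₂ := IsPrimitiveOn.of_hasDerivWithinAt hab (hp₂.continuousOn hab) hy₂
  refine ((hy₁p₁.smul hab hp₂).sub (hp₁.smul hab hy₂p₂)).congr hab fun t _ => ?_
  simp only [smul_eq_mul, Complex.real_smul]
  ring

theorem sub_mul_integral_mul (hab : a ≤ b) (hV : MemLp V 2 (volume.restrict (Icc a b)))
    {z₁ z₂ : ℂ} {y₁ p₁ y₂ p₂ : ℝ → ℂ} (h₁ : IsSolution a b V z₁ y₁ p₁)
    (h₂ : IsSolution a b V z₂ y₂ p₂) :
    (z₁ - z₂) * ∫ t in a..b, y₁ t * y₂ t =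
      (y₁ b * p₂ b - p₁ b * y₂ b) - (y₁ a * p₂ a - p₁ a * y₂ a) := by
  rw [← intervalIntegral.integral_const_mul]
  exact ((isPrimitiveOn_wronskian hab hV h₁ h₂).sub_eq_integral (left_mem_Icc.2 hab)
    (right_mem_Icc.2 hab)).symm

theorem integral_normSq_pos (hab : a < b) (h : IsSolution a b V z y p)
    (hne : y a ≠ 0 ∨ p a ≠ 0) : 0 < ∫ t in a..b, Complex.normSq (y t) := by
  have hcont : ContinuousOn (fun t => Complex.normSq (y t)) (Icc a b) :=
    Complex.continuous_normSq.comp_continuousOn h.continuousOn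
  refine intervalIntegral.integral_pos hab hcont (fun t _ => Complex.normSq_nonneg _) ?_
  by_contra! hzero
  have hy : EqOn y 0 (Icc a b) := fun t ht =>
    Complex.normSq_eq_zero.1 ((hzero t ht).antisymm (Complex.normSq_nonneg _))
  have ha : a ∈ Icc a b := left_mem_Icc.2 hab.le
  have hp : p a = 0 := (uniqueDiffOn_Icc hab a ha).eq_deriv _ (h.hasDerivWithinAt ha)
    ((hasDerivWithinAt_const a _ 0).congr_of_mem hy ha)
  exact hne.elim (fun h0 => h0 (hy ha)) (fun h0 => h0 hp)

theorem im_eq_zero (hab : a < b) (hV : MemLp V 2 (volume.restrict (Icc a b)))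
    (h : IsSolution a b V z y p) (hne : y a ≠ 0 ∨ p a ≠ 0)
    (hbd : y b * star (p b) - p b * star (y b) = y a * star (p a) - p a * star (y a)) :
    z.im = 0 := by
  have hlag := sub_mul_integral_mul hab.le hV h h.star
  simp only [Pi.star_apply, hbd, sub_self] at hlag
  simp only [Complex.star_def, Complex.mul_conj, intervalIntegral.integral_ofReal] at hlag
  refine Complex.conj_eq_iff_im.1 (sub_eq_zero.1 ((mul_eq_zero.1 hlag).resolve_right ?_)).symm
  exact Complex.ofReal_ne_zero.2 (h.integral_normSq_pos hab hne).ne'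

end IsSolution

end Solutions

section FundamentalSystem

variable {a b : ℝ} {V : ℝ → ℝ}

/-- For every `z`, the function `y z` with derivative `p z` solves `-y'' + V y = z y` on `[a,b]`
with the fixed initial values `y(a) = v₀`, `y'(a) = v₁`, and the dependence on `z` is entire. -/
structure IsSolutionFamily (a b : ℝ) (V : ℝ → ℝ) (v₀ v₁ : ℂ) (y p : ℂ → ℝ → ℂ) : Prop where
  isSolution : ∀ z, IsSolution a b V z (y z) (p z)
  val_left : ∀ z, y z a = v₀
  der_left : ∀ z, p z a = v₁
  differentiable_val : ∀ t, Differentiable ℂ (y · t)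
  differentiable_der : ∀ t, Differentiable ℂ (p · t)
  continuous_val : Continuous y.uncurry

theorem exists_isSolutionFamily (hab : a ≤ b) (hV : MemLp V 2 (volume.restrict (Icc a b)))
    (v₀ v₁ : ℂ) : ∃ y p, IsSolutionFamily a b V v₀ v₁ y p := by
  obtain ⟨Q, w, hR, -⟩ := exists_isRegularization hab (hV.integrable one_le_two) one_pos
  have hQ := hR.isPrimitiveOn.continuousOn hab
  obtain ⟨y, u, hs, hdiff, hcont⟩ := exists_isRegularizedSystem hab hQ
    (q := fun t => w t - Q t ^ 2) (hR.continuousOn.sub (hQ.pow 2)) (v₀, v₁ - Q a • v₀)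
  refine ⟨y, fun z t => u z t + Q t • y z t, fun z => (hR.isSolution_iff hab hV).2 ?_,
    fun z => (hs z).2.1, fun z => ?_, fun t => (hdiff t).1,
    fun t => (hdiff t).2.add ((hdiff t).1.const_smul (Q t)), hcont⟩
  · simpa only [add_sub_cancel_right] using (hs z).1
  · rw [(hs z).2.1, (hs z).2.2, sub_add_cancel]

theorem IsSolutionFamily.star_apply (hab : a ≤ b) (hV : MemLp V 2 (volume.restrict (Icc a b)))
    {v₀ v₁ : ℂ} {y p : ℂ → ℝ → ℂ} (h : IsSolutionFamily a b V v₀ v₁ y p) (hv₀ : star v₀ = v₀)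
    (hv₁ : star v₁ = v₁) (z : ℂ) {t : ℝ} (ht : t ∈ Icc a b) :
    star (y z t) = y (star z) t ∧ star (p z t) = p (star z) t :=
  ((h.isSolution z).star.eqOn hab hV (h.isSolution (star z))
    (by rw [Pi.star_apply, h.val_left, h.val_left, hv₀])
    (by rw [Pi.star_apply, h.der_left, h.der_left, hv₁])).imp (· ht) (· ht)

/-- The solutions `c, s` of `-y'' + V y = z y` on `[a,b]` with `c(a) = s'(a) = 1` and
`c'(a) = s(a) = 0`; their derivatives are `dc, ds`. -/
structure IsFundamentalSystem (a b : ℝ) (V : ℝ → ℝ) (c dc s ds : ℂ → ℝ → ℂ) : Prop where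
  cosine : IsSolutionFamily a b V 1 0 c dc
  sine : IsSolutionFamily a b V 0 1 s ds

theorem exists_isFundamentalSystem (hab : a ≤ b) (hV : MemLp V 2 (volume.restrict (Icc a b))) :
    ∃ c dc s ds, IsFundamentalSystem a b V c dc s ds := by
  obtain ⟨c, dc, hc⟩ := exists_isSolutionFamily hab hV 1 0
  obtain ⟨s, ds, hs⟩ := exists_isSolutionFamily hab hV 0 1
  exact ⟨c, dc, s, ds, hc, hs⟩

namespace IsFundamentalSystem

variable {c dc s ds : ℂ → ℝ → ℂ}

theorem isSolution_combination (h : IsFundamentalSystem a b V c dc s ds) (z v₀ v₁ : ℂ) :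
    IsSolution a b V z (v₀ • c z + v₁ • s z) (v₀ • dc z + v₁ • ds z) :=
  ((h.cosine.isSolution z).smul v₀).add ((h.sine.isSolution z).smul v₁)

theorem eq_combination (hab : a ≤ b) (hV : MemLp V 2 (volume.restrict (Icc a b)))
    (h : IsFundamentalSystem a b V c dc s ds) {z : ℂ} {y p : ℝ → ℂ}
    (hy : IsSolution a b V z y p) {t : ℝ} (ht : t ∈ Icc a b) :
    y t = y a * c z t + p a * s z t ∧ p t = y a * dc z t + p a * ds z t :=
  (hy.eqOn hab hV (h.isSolution_combination z (y a) (p a))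
    (by simp [h.cosine.val_left, h.sine.val_left])
    (by simp [h.cosine.der_left, h.sine.der_left])).imp (· ht) (· ht)

theorem wronskian_eq_one (hab : a ≤ b) (hV : MemLp V 2 (volume.restrict (Icc a b)))
    (h : IsFundamentalSystem a b V c dc s ds) (z : ℂ) :
    c z b * ds z b - dc z b * s z b = 1 := by
  have hlag := IsSolution.sub_mul_integral_mul hab hV (h.cosine.isSolution z) (h.sine.isSolution z)
  simp only [h.cosine.val_left, h.cosine.der_left, h.sine.val_left, h.sine.der_left] at hlag
  linear_combination -hlag

theorem im_right_eq_zero (hab : a ≤ b) (hV : MemLp V 2 (volume.restrict (Icc a b)))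
    (h : IsFundamentalSystem a b V c dc s ds) (x : ℝ) :
    (c x b).im = 0 ∧ (s x b).im = 0 ∧ (ds x b).im = 0 := by
  have hb : b ∈ Icc a b := right_mem_Icc.2 hab
  have hc := h.cosine.star_apply hab hV (by simp) (by simp) x hb
  have hs := h.sine.star_apply hab hV (by simp) (by simp) x hb
  rw [Complex.star_def, Complex.conj_ofReal] at hc hs
  exact ⟨Complex.conj_eq_iff_im.1 hc.1, Complex.conj_eq_iff_im.1 hs.1,
    Complex.conj_eq_iff_im.1 hs.2⟩

theorem im_eq_zero_of_sine_right_eq_zero (hab : a < b)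
    (hV : MemLp V 2 (volume.restrict (Icc a b))) (h : IsFundamentalSystem a b V c dc s ds) {z : ℂ}
    (hz : s z b = 0) : z.im = 0 :=
  (h.sine.isSolution z).im_eq_zero hab hV (by simp [h.sine.der_left])
    (by simp [hz, h.sine.val_left])

theorem hasDerivAt_sine_mul (hab : a ≤ b) (hV : MemLp V 2 (volume.restrict (Icc a b)))
    (h : IsFundamentalSystem a b V c dc s ds) {x : ℂ} (hx : s x b = 0) :
    HasDerivAt (fun z => s z b * ds x b) (∫ t in a..b, s x t * s x t) x := by
  have hcont : Continuous fun z => ∫ t in a..b, s z t * s x t :=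
    intervalIntegral.continuous_parametric_intervalIntegral_of_continuous'
      (h.sine.continuous_val.mul ((h.sine.continuous_val.uncurry_left x).comp continuous_snd)) a b
  have hlag : ∀ z, s z b * ds x b = (z - x) * ∫ t in a..b, s z t * s x t := fun z => by
    rw [IsSolution.sub_mul_integral_mul hab hV (h.sine.isSolution z) (h.sine.isSolution x), hx,
      h.sine.val_left, h.sine.val_left]
    ring
  refine hasDerivAt_iff_tendsto_slope.2
    ((hcont.continuousAt.tendsto.mono_left nhdsWithin_le_nhds).congr' ?_)
  filter_upwards [self_mem_nhdsWithin] with z hz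
  rw [slope_def_field, hlag z, hlag x, sub_self, zero_mul, sub_zero,
    mul_div_cancel_left₀ _ (sub_ne_zero.2 hz)]

theorem deriv_sine_mul_pos (hab : a < b) (hV : MemLp V 2 (volume.restrict (Icc a b)))
    (h : IsFundamentalSystem a b V c dc s ds) {x : ℝ} (hx : s x b = 0) :
    0 < deriv (fun r : ℝ => (s r b).re) x * (ds x b).re := by
  have hreal : ∀ t ∈ Icc a b, s x t * s x t = (Complex.normSq (s x t) : ℂ) := fun t ht => by
    have := (h.sine.star_apply hab.le hV (by simp) (by simp) x ht).1
    rw [Complex.star_def, Complex.conj_ofReal] at this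
    rw [← Complex.mul_conj, this]
  have hderiv := (h.hasDerivAt_sine_mul hab.le hV hx).real_of_complex
  rw [intervalIntegral.integral_congr (uIcc_of_le hab.le ▸ hreal),
    intervalIntegral.integral_ofReal, Complex.ofReal_re] at hderiv
  simp only [Complex.mul_re, (h.im_right_eq_zero hab.le hV _).2.2, mul_zero, sub_zero] at hderiv
  have hs : DifferentiableAt ℝ (fun r : ℝ => (s r b).re) x :=
    (h.sine.differentiable_val b x).hasDerivAt.real_of_complex.differentiableAt
  rw [(hs.hasDerivAt.mul_const _).unique hderiv]
  exact (h.sine.isSolution x).integral_normSq_pos hab (by simp [h.sine.der_left])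

end IsFundamentalSystem

end FundamentalSystem

section Calculus

theorem eventually_nhdsGT_lt_of_hasDerivWithinAt_pos {f : ℝ → ℝ} {d a : ℝ}
    (hf : HasDerivWithinAt f d (Ioi a) a) (hd : 0 < d) : ∀ᶠ t in 𝓝[>] a, f a < f t := by
  have hslope := (hasDerivWithinAt_iff_tendsto_slope' self_notMem_Ioi).1 hf
  filter_upwards [hslope.eventually (lt_mem_nhds hd), self_mem_nhdsWithin] with t ht hat
  exact (slope_pos_iff_of_le (le_of_lt hat)).1 ht

theorem nonpos_of_hasDerivAt_of_eventually_le {f : ℝ → ℝ} {d b : ℝ} (hf : HasDerivAt f d b)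
    (hle : ∀ᶠ t in 𝓝[<] b, f b ≤ f t) : d ≤ 0 := by
  have hslope := (hasDerivWithinAt_iff_tendsto_slope' self_notMem_Iio).1
    (hf.hasDerivWithinAt (s := Iio b))
  refine le_of_tendsto hslope ?_
  filter_upwards [hle, self_mem_nhdsWithin] with t ht htb
  rw [slope_comm, slope_def_field]
  exact div_nonpos_of_nonpos_of_nonneg (sub_nonpos.2 ht) (sub_nonneg.2 (le_of_lt htb))

end Calculus

section RealSystem

variable {a b x : ℝ} {Q q Y U : ℝ → ℝ}

/-- The wave `U + i k Y`, which would be `exp(i k (t - a))` for `Q = q = 0`, relative to this free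
wave. -/
def relativeWave (a k : ℝ) (Y U : ℝ → ℝ) (t : ℝ) : ℂ :=
  ⟨U t, k * Y t⟩ * Complex.exp ((-(k * (t - a)) : ℝ) * Complex.I)

theorem norm_relativeWave_deriv_le {k ε : ℝ} (hk : 0 ≤ k) {t : ℝ} (hQ : |Q t| ≤ ε)
    (hq : |q t| ≤ ε * k) :
    ‖(-(Q t) * star (⟨U t, k * Y t⟩ : ℂ) + (q t * Y t : ℝ)) *
        Complex.exp ((-(k * (t - a)) : ℝ) * Complex.I)‖ ≤ 2 * ε * ‖relativeWave a k Y U t‖ := by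
  have hε : 0 ≤ ε := (abs_nonneg _).trans hQ
  have hY : k * |Y t| ≤ ‖(⟨U t, k * Y t⟩ : ℂ)‖ := by
    simpa [abs_mul, abs_of_nonneg hk] using Complex.abs_im_le_norm ⟨U t, k * Y t⟩
  rw [relativeWave, norm_mul, norm_mul, Complex.norm_exp_ofReal_mul_I, mul_one, mul_one]
  calc ‖-(Q t : ℂ) * star (⟨U t, k * Y t⟩ : ℂ) + (q t * Y t : ℝ)‖
      ≤ |Q t| * ‖(⟨U t, k * Y t⟩ : ℂ)‖ + |q t| * |Y t| := by
        refine (norm_add_le _ _).trans_eq ?_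
        rw [norm_mul, norm_neg, norm_star, Complex.norm_real, Complex.norm_real, norm_mul]
        rfl
    _ ≤ ε * ‖(⟨U t, k * Y t⟩ : ℂ)‖ + ε * k * |Y t| := by gcongr
    _ ≤ 2 * ε * ‖(⟨U t, k * Y t⟩ : ℂ)‖ := by
        linear_combination mul_le_mul_of_nonneg_left hY hε

namespace IsRegularizedSystem

theorem monotoneOn_mul (h : IsRegularizedSystem a b Q q x Y U) (hx : ∀ t ∈ Icc a b, x ≤ q t) :
    MonotoneOn (fun t => Y t * U t) (Icc a b) := by
  refine monotoneOn_of_hasDerivWithinAt_nonneg (convex_Icc a b)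
    (h.continuousOn_fst.mul h.continuousOn_snd) (f' := fun t => U t ^ 2 + (q t - x) * Y t ^ 2)
    (fun t ht => ?_) (fun t ht => ?_)
  · refine (((h.deriv_fst t (interior_subset ht)).mul
      (h.deriv_snd t (interior_subset ht))).mono interior_subset).congr_deriv ?_
    simp only [smul_eq_mul]
    ring
  · have := sub_nonneg.2 (hx t (interior_subset ht))
    positivity

theorem eventually_pos (hab : a < b) (h : IsRegularizedSystem a b Q q x Y U) (hY : Y a = 0)
    (hU : 0 < U a) : ∀ᶠ t in 𝓝[>] a, 0 < Y t ∧ 0 < U t := by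
  have ha : a ∈ Icc a b := left_mem_Icc.2 hab.le
  have hder : HasDerivWithinAt Y (U a) (Ioi a) a :=
    ((h.deriv_fst a ha).congr_deriv (by simp [hY])).mono_of_mem_nhdsWithin (Icc_mem_nhdsGT hab)
  have hcont : Tendsto U (𝓝[>] a) (𝓝 (U a)) :=
    (h.continuousOn_snd a ha).mono_left (nhdsWithin_le_of_mem (Icc_mem_nhdsGT hab))
  filter_upwards [eventually_nhdsGT_lt_of_hasDerivWithinAt_pos hder hU,
    hcont.eventually (lt_mem_nhds hU)] with t hYt hUt
  exact ⟨hY ▸ hYt, hUt⟩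

theorem pos_right (hab : a < b) (h : IsRegularizedSystem a b Q q x Y U) (hY : Y a = 0)
    (hU : 0 < U a) (hx : ∀ t ∈ Icc a b, x ≤ q t) : 0 < Y b := by
  obtain ⟨δ, ⟨hYδ, hUδ⟩, haδ, hδb⟩ :=
    ((h.eventually_pos hab hY hU).and (Ioo_mem_nhdsGT hab)).exists
  by_contra! hYb
  obtain ⟨t, ⟨hδt, htb⟩, hYt⟩ := intermediate_value_Icc' hδb.le
    (h.continuousOn_fst.mono (Icc_subset_Icc_left haδ.le)) ⟨hYb, hYδ.le⟩
  have hle : Y δ * U δ ≤ Y t * U t :=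
    h.monotoneOn_mul hx ⟨haδ.le, hδb.le⟩ ⟨haδ.le.trans hδt, htb⟩ hδt
  rw [hYt, zero_mul] at hle
  exact (mul_pos hYδ hUδ).not_ge hle

theorem hasDerivWithinAt_relativeWave {k : ℝ} (h : IsRegularizedSystem a b Q q (k ^ 2) Y U)
    {t : ℝ} (ht : t ∈ Icc a b) :
    HasDerivWithinAt (relativeWave a k Y U)
      ((-(Q t) * star (⟨U t, k * Y t⟩ : ℂ) + (q t * Y t : ℝ)) *
        Complex.exp ((-(k * (t - a)) : ℝ) * Complex.I)) (Icc a b) t := by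
  have hwave : HasDerivWithinAt (fun t => (⟨U t, k * Y t⟩ : ℂ))
      ⟨-(Q t • U t) + q t • Y t - k ^ 2 * Y t, k * (Q t • Y t + U t)⟩ (Icc a b) t := by
    simp only [Complex.mk_eq_add_mul_I]
    exact (h.deriv_snd t ht).ofReal_comp.fun_add
      (((h.deriv_fst t ht).const_mul k).ofReal_comp.mul_const _)
  have hphase : HasDerivWithinAt (fun t : ℝ => ((-(k * (t - a)) : ℝ) : ℂ) * Complex.I)
      ((-(k * 1) : ℝ) * Complex.I) (Icc a b) t :=
    ((((hasDerivAt_id t).sub_const a).const_mul k).fun_neg.ofReal_comp.mul_const _).hasDerivWithinAt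
  refine (hwave.mul hphase.cexp).congr_deriv ?_
  simp only [Complex.mk_eq_add_mul_I, Complex.star_def, map_add, map_mul, Complex.conj_ofReal,
    Complex.conj_I, smul_eq_mul]
  push_cast
  linear_combination -(k ^ 2 * Y t * Complex.exp (-(k * (t - a)) * Complex.I)) * Complex.I_sq

theorem norm_relativeWave_sub_one_le (hab : a ≤ b) {k ε : ℝ} (hk : 0 ≤ k) (hε : 0 < ε)
    (h : IsRegularizedSystem a b Q q (k ^ 2) Y U) (hY : Y a = 0) (hU : U a = 1)
    (hQ : ∀ t ∈ Icc a b, |Q t| ≤ ε) (hq : ∀ t ∈ Icc a b, |q t| ≤ ε * k) :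
    ‖relativeWave a k Y U b - 1‖ ≤ Real.exp (2 * ε * (b - a)) - 1 := by
  have hderiv := fun t ht => (h.hasDerivWithinAt_relativeWave (t := t) ht).sub_const 1
  have hinit : relativeWave a k Y U a = 1 := by
    apply Complex.ext <;> simp [relativeWave, hY, hU]
  have hgronwall := norm_le_gronwallBound_of_norm_deriv_right_le (δ := 0) (K := 2 * ε)
    (ε := 2 * ε) (fun t ht => (hderiv t ht).continuousWithinAt)
    (fun t ht => (hderiv t ⟨ht.1, ht.2.le⟩).mono_of_mem_nhdsWithin (Icc_mem_nhdsGE_of_mem ht))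
    (by simp [hinit]) (fun t ht => ?_) b (right_mem_Icc.2 hab)
  · simpa [gronwallBound_of_K_ne_0, hε.ne'] using hgronwall
  · have ht' : t ∈ Icc a b := ⟨ht.1, ht.2.le⟩
    have hone : ‖relativeWave a k Y U t‖ ≤ ‖relativeWave a k Y U t - 1‖ + 1 := by
      simpa using norm_add_le (relativeWave a k Y U t - 1) 1
    refine (norm_relativeWave_deriv_le hk (hQ t ht') (hq t ht')).trans ?_
    linear_combination 2 * ε * hone

theorem abs_mul_sub_sin_le (hab : a ≤ b) {k ε : ℝ} (hk : 0 ≤ k) (hε : 0 < ε)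
    (h : IsRegularizedSystem a b Q q (k ^ 2) Y U) (hY : Y a = 0) (hU : U a = 1)
    (hQ : ∀ t ∈ Icc a b, |Q t| ≤ ε) (hq : ∀ t ∈ Icc a b, |q t| ≤ ε * k) :
    |k * Y b - Real.sin (k * (b - a))| ≤ Real.exp (2 * ε * (b - a)) - 1 := by
  refine le_trans ?_ (h.norm_relativeWave_sub_one_le hab hk hε hY hU hQ hq)
  have hfree : ‖Complex.exp ((k * (b - a) : ℝ) * Complex.I)‖ = 1 :=
    Complex.norm_exp_ofReal_mul_I _
  have hwave : Complex.exp ((k * (b - a) : ℝ) * Complex.I) * relativeWave a k Y U b =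
      ⟨U b, k * Y b⟩ := by
    rw [relativeWave, mul_left_comm, ← Complex.exp_add, ← add_mul, ← Complex.ofReal_add,
      add_neg_cancel, Complex.ofReal_zero, zero_mul, Complex.exp_zero, mul_one]
  rw [← one_mul ‖_ - 1‖, ← hfree, ← norm_mul, mul_sub (Complex.exp _), mul_one, hwave]
  have him := Complex.abs_im_le_norm (⟨U b, k * Y b⟩ - Complex.exp ((k * (b - a) : ℝ) * Complex.I))
  rwa [Complex.sub_im, Complex.exp_ofReal_mul_I_im] at him

end IsRegularizedSystem

end RealSystem

theorem frequently_sin_mul_eq {l : ℝ} (hl : 0 < l) (θ : ℝ) :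
    ∃ᶠ k in atTop, Real.sin (k * l) = Real.sin θ := by
  have htop : Tendsto (fun n : ℕ => (θ + n * (2 * Real.pi)) / l) atTop atTop :=
    (tendsto_atTop_add_const_left _ _ (tendsto_natCast_atTop_atTop.atTop_mul_const
      Real.two_pi_pos)).atTop_div_const hl
  refine htop.frequently (Frequently.of_forall fun n => ?_)
  rw [div_mul_cancel₀ _ hl.ne', Real.sin_add_nat_mul_two_pi]

theorem frequently_eq_zero_of_frequently_pos_of_frequently_neg {f : ℝ → ℝ} (hf : Continuous f)
    (hpos : ∃ᶠ x in atTop, 0 < f x) (hneg : ∃ᶠ x in atTop, f x < 0) :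
    ∃ᶠ x in atTop, f x = 0 := by
  refine frequently_atTop.2 fun R => ?_
  obtain ⟨u, hRu, hu⟩ := frequently_atTop.1 hpos R
  obtain ⟨v, hRv, hv⟩ := frequently_atTop.1 hneg R
  obtain ⟨t, ht, hft⟩ := intermediate_value_uIcc (hf.continuousOn (s := uIcc u v))
    (mem_uIcc.2 (.inr ⟨hv.le, hu.le⟩))
  exact ⟨t, (le_min hRu hRv).trans ht.1, hft⟩

section FundamentalSystem

variable {a b : ℝ} {V : ℝ → ℝ}

namespace IsFundamentalSystem

variable {c dc s ds : ℂ → ℝ → ℂ}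

theorem continuous_sine_right_re (h : IsFundamentalSystem a b V c dc s ds) :
    Continuous fun x : ℝ => (s x b).re :=
  Complex.continuous_re.comp
    ((h.sine.differentiable_val b).continuous.comp Complex.continuous_ofReal)

theorem isRegularizedSystem_sine_re (hab : a ≤ b) (hV : MemLp V 2 (volume.restrict (Icc a b)))
    (h : IsFundamentalSystem a b V c dc s ds) {Q w : ℝ → ℝ} (hR : IsRegularization a b V Q w)
    (x : ℝ) : IsRegularizedSystem a b Q (fun t => w t - Q t ^ 2) x (fun t => (s x t).re)
      (fun t => (ds x t - Q t • s x t).re) :=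
  ((hR.isSolution_iff hab hV).1 (h.sine.isSolution x)).re

theorem eventually_sine_right_pos (hab : a < b) (hV : MemLp V 2 (volume.restrict (Icc a b)))
    (h : IsFundamentalSystem a b V c dc s ds) : ∀ᶠ x : ℝ in atBot, 0 < (s x b).re := by
  obtain ⟨Q, w, hR, -⟩ := exists_isRegularization hab.le (hV.integrable one_le_two) one_pos
  have hq := hR.continuousOn.sub ((hR.isPrimitiveOn.continuousOn hab.le).pow 2)
  obtain ⟨x₀, hx₀⟩ := isCompact_Icc.bddBelow_image hq
  filter_upwards [eventually_le_atBot x₀] with x hx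
  exact (h.isRegularizedSystem_sine_re hab.le hV hR x).pos_right hab
    (by simp [h.sine.val_left]) (by simp [h.sine.val_left, h.sine.der_left])
    fun t ht => hx.trans (hx₀ (mem_image_of_mem _ ht))

theorem tendsto_mul_sine_right_sub_sin (hab : a ≤ b)
    (hV : MemLp V 2 (volume.restrict (Icc a b))) (h : IsFundamentalSystem a b V c dc s ds) :
    Tendsto (fun k : ℝ => k * (s (k ^ 2 : ℝ) b).re - Real.sin (k * (b - a))) atTop (𝓝 0) := by
  refine Metric.tendsto_nhds.2 fun δ hδ => ?_
  have hexp : Tendsto (fun ε : ℝ => Real.exp (2 * ε * (b - a)) - 1) (𝓝[>] 0) (𝓝 0) := by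
    have : Continuous fun ε : ℝ => Real.exp (2 * ε * (b - a)) - 1 := by fun_prop
    simpa using (this.tendsto 0).mono_left nhdsWithin_le_nhds
  obtain ⟨ε, hεδ, hε⟩ := ((hexp.eventually (gt_mem_nhds hδ)).and self_mem_nhdsWithin).exists
  obtain ⟨Q, w, hR, hQ⟩ := exists_isRegularization hab (hV.integrable one_le_two) hε
  have hq := hR.continuousOn.sub ((hR.isPrimitiveOn.continuousOn hab).pow 2)
  obtain ⟨M, hM⟩ := isCompact_Icc.exists_bound_of_continuousOn hq
  filter_upwards [eventually_ge_atTop 0, eventually_ge_atTop (M / ε)] with k hk hMk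
  rw [Real.dist_0_eq_abs]
  exact ((h.isRegularizedSystem_sine_re hab hV hR (k ^ 2)).abs_mul_sub_sin_le hab hk hε
    (by simp [h.sine.val_left]) (by simp [h.sine.val_left, h.sine.der_left]) hQ
    fun t ht => (hM t ht).trans ((div_le_iff₀' hε).1 hMk)).trans_lt hεδ

theorem frequently_sine_right_eq_zero (hab : a < b)
    (hV : MemLp V 2 (volume.restrict (Icc a b))) (h : IsFundamentalSystem a b V c dc s ds) :
    ∃ᶠ x : ℝ in atTop, (s x b).re = 0 := by
  have hclose := (h.tendsto_mul_sine_right_sub_sin hab.le hV).eventually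
    (Metric.ball_mem_nhds 0 one_pos)
  simp only [Real.dist_0_eq_abs, abs_lt] at hclose
  have hsq : Tendsto (fun k : ℝ => k ^ 2) atTop atTop := tendsto_pow_atTop two_ne_zero
  refine frequently_eq_zero_of_frequently_pos_of_frequently_neg h.continuous_sine_right_re
    (hsq.frequently ?_) (hsq.frequently ?_)
  · refine ((frequently_sin_mul_eq (sub_pos.2 hab) (Real.pi / 2)).and_eventually
      (hclose.and (eventually_gt_atTop 0))).mono fun k ⟨hsin, hk, hk0⟩ => ?_
    rw [Real.sin_pi_div_two] at hsin
    exact pos_of_mul_pos_right (by linarith [hk.1]) hk0.le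
  · refine ((frequently_sin_mul_eq (sub_pos.2 hab) (-(Real.pi / 2))).and_eventually
      (hclose.and (eventually_gt_atTop 0))).mono fun k ⟨hsin, hk, hk0⟩ => ?_
    rw [Real.sin_neg, Real.sin_pi_div_two] at hsin
    exact neg_of_mul_neg_right (by linarith [hk.2]) hk0.le

end IsFundamentalSystem

end FundamentalSystem

section SimpleZeros

theorem exists_strictMono_range_eq {α : Type*} [LinearOrder α] {S : Set α}
    (hfin : ∀ a b, (S ∩ Icc a b).Finite) (hne : S.Nonempty) (hbelow : BddBelow S)
    (habove : ¬BddAbove S) : ∃ μ : ℕ → α, StrictMono μ ∧ range μ = S := by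
  obtain ⟨x₀, hx₀⟩ := hne
  obtain ⟨m, hm⟩ := hbelow
  obtain ⟨bot, hbot⟩ := (hfin m x₀).exists_minimal ⟨x₀, hx₀, hm hx₀, le_rfl⟩
  have hleast : ∀ x ∈ S, bot ≤ x := fun x hx => by
    by_contra! hlt
    exact hlt.not_ge (hbot.2 ⟨hx, hm hx, hlt.le.trans hbot.1.2.2⟩ hlt.le)
  let _ : OrderBot S := { bot := ⟨bot, hbot.1.1⟩, bot_le := fun x => hleast x x.2 }
  let _ : LocallyFiniteOrder S := .ofFiniteIcc fun a b =>
    ((hfin a b).preimage Subtype.val_injective.injOn).subset fun x hx => ⟨x.2, hx⟩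
  have : NoMaxOrder S := ⟨fun x => by
    obtain ⟨y, hy, hxy⟩ := not_bddAbove_iff.1 habove x
    exact ⟨⟨y, hy⟩, hxy⟩⟩
  let _ := LinearLocallyFiniteOrder.succOrder S
  let _ := LinearLocallyFiniteOrder.predOrder S
  let e := (orderIsoNatOfLinearSuccPredArch (ι := S)).symm
  exact ⟨fun k => e k, fun i j hij => e.strictMono hij, by
    rw [range_comp' Subtype.val e, e.surjective.range_eq, image_univ, Subtype.range_coe]⟩

theorem pos_of_isPreconnected_of_ne_zero {X : Type*} [TopologicalSpace X] {S : Set X}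
    (hS : IsPreconnected S) {f : X → ℝ} (hf : ContinuousOn f S) (hne : ∀ x ∈ S, f x ≠ 0) {x y : X}
    (hx : x ∈ S) (hy : y ∈ S) (hfx : 0 < f x) : 0 < f y := by
  by_contra! hfy
  obtain ⟨t, ht, hft⟩ := hS.intermediate_value hy hx hf ⟨hfy, hfx.le⟩
  exact hne t ht hft

variable {f f' : ℝ → ℝ}

theorem finite_zeros_inter_Icc (hf : ∀ x, HasDerivAt f (f' x) x) (hsimple : ∀ x, f x = 0 → f' x ≠ 0)
    (a b : ℝ) : ({x | f x = 0} ∩ Icc a b).Finite := by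
  by_contra hinf
  obtain ⟨c, -, hc⟩ := Set.Infinite.exists_accPt_of_subset_isCompact hinf isCompact_Icc
    inter_subset_right
  have hc' : AccPt c (𝓟 {x | f x = 0}) := hc.mono (principal_mono.2 inter_subset_left)
  have hclosed : IsClosed {x | f x = 0} :=
    isClosed_eq (continuous_iff_continuousAt.2 fun x => (hf x).continuousAt) continuous_const
  have hc0 : f c = 0 := hclosed.closure_eq.subset (mem_closure_iff_clusterPt.2 hc'.clusterPt)
  exact accPt_iff_frequently_nhdsNE.1 hc'
    (((hf c).eventually_ne (c := 0) (hsimple c hc0)).mono fun x hx h => hx h)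

theorem deriv_neg_of_pos_left {a b d : ℝ} (hab : a < b) (hfb : HasDerivAt f d b) (hb : f b = 0)
    (hd : d ≠ 0) (hpos : ∀ x ∈ Ioo a b, 0 < f x) : d < 0 := by
  refine lt_of_le_of_ne (nonpos_of_hasDerivAt_of_eventually_le hfb ?_) hd
  filter_upwards [Ioo_mem_nhdsLT hab] with t ht
  exact hb ▸ (hpos t ht).le

theorem deriv_mul_deriv_neg_of_consecutive_zeros {a b : ℝ} (hab : a < b)
    (hf : ∀ x, HasDerivAt f (f' x) x) (ha : f a = 0) (hb : f b = 0) (hfa : f' a ≠ 0)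
    (hfb : f' b ≠ 0) (hne : ∀ x ∈ Ioo a b, f x ≠ 0) : f' a * f' b < 0 := by
  wlog hpos : 0 < f' a generalizing f f'
  · have := this (f := -f) (f' := -f') (fun x => (hf x).neg) (neg_eq_zero.2 ha)
      (neg_eq_zero.2 hb) (neg_ne_zero.2 hfa) (neg_ne_zero.2 hfb)
      (fun x hx => neg_ne_zero.2 (hne x hx)) (neg_pos.2 (lt_of_le_of_ne (not_lt.1 hpos) hfa))
    rwa [Pi.neg_apply, Pi.neg_apply, neg_mul_neg] at this
  obtain ⟨x, hfx, hx⟩ := ((eventually_nhdsGT_lt_of_hasDerivWithinAt_pos (hf a).hasDerivWithinAt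
    hpos).and (Ioo_mem_nhdsGT hab)).exists
  have hcont : ContinuousOn f (Ioo a b) := fun x _ => (hf x).continuousAt.continuousWithinAt
  exact mul_neg_of_pos_of_neg hpos (deriv_neg_of_pos_left hab (hf b) hb hfb fun y hy =>
    pos_of_isPreconnected_of_ne_zero isPreconnected_Ioo hcont hne hx hy (ha ▸ hfx))

theorem neg_one_pow_mul_deriv_neg_of_zeros (hf : ∀ x, HasDerivAt f (f' x) x)
    (hsimple : ∀ x, f x = 0 → f' x ≠ 0) (hpos : ∀ᶠ x in atBot, 0 < f x) {μ : ℕ → ℝ}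
    (hμ : StrictMono μ) (hrange : range μ = {x | f x = 0}) (k : ℕ) :
    (-1) ^ k * f' (μ k) < 0 := by
  have hzero : ∀ k, f (μ k) = 0 := fun k => hrange.subset (mem_range_self k)
  induction k with
  | zero =>
    have hcont : ContinuousOn f (Iio (μ 0)) := fun x _ => (hf x).continuousAt.continuousWithinAt
    have hne : ∀ x ∈ Iio (μ 0), f x ≠ 0 := fun x hx hfx => by
      obtain ⟨k, rfl⟩ := hrange.superset hfx
      exact (hμ.monotone k.zero_le).not_gt hx
    obtain ⟨x, hfx, hx⟩ := (hpos.and (eventually_lt_atBot (μ 0))).exists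
    rw [pow_zero, one_mul]
    exact deriv_neg_of_pos_left hx (hf _) (hzero 0) (hsimple _ (hzero 0)) fun y hy =>
      pos_of_isPreconnected_of_ne_zero isPreconnected_Iio hcont hne hx hy.2 hfx
  | succ k ih =>
    have hne : ∀ x ∈ Ioo (μ k) (μ (k + 1)), f x ≠ 0 := fun x hx hfx => by
      obtain ⟨j, rfl⟩ := hrange.superset hfx
      have := hμ.lt_iff_lt.1 hx.1
      have := hμ.lt_iff_lt.1 hx.2
      omega
    have hconsec := deriv_mul_deriv_neg_of_consecutive_zeros (hμ k.lt_succ_self) hf (hzero k)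
      (hzero (k + 1)) (hsimple _ (hzero k)) (hsimple _ (hzero (k + 1))) hne
    rw [pow_succ, mul_neg_one, neg_mul, neg_lt_zero]
    refine pos_of_mul_neg_right ?_ ih.le
    rw [mul_mul_mul_comm, ← mul_pow, neg_one_mul, neg_neg, one_pow, one_mul]
    exact hconsec

end SimpleZeros

namespace IsFundamentalSystem

variable {a b : ℝ} {V : ℝ → ℝ} {c dc s ds : ℂ → ℝ → ℂ}

theorem exists_strictMono_sine_right_zeros (hab : a < b)
    (hV : MemLp V 2 (volume.restrict (Icc a b))) (h : IsFundamentalSystem a b V c dc s ds) :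
    ∃ μ : ℕ → ℝ, StrictMono μ ∧ (∀ z, s z b = 0 ↔ ∃ k, z = μ k) ∧
      ∀ k, (-1) ^ k * (ds (μ k) b).re < 0 := by
  let f : ℝ → ℝ := fun x => (s x b).re
  have hreal : ∀ x : ℝ, f x = 0 ↔ s x b = 0 := fun x =>
    ⟨fun hx => Complex.ext hx (h.im_right_eq_zero hab.le hV x).2.1, fun hx => by simp [f, hx]⟩
  have hf : ∀ x, HasDerivAt f (deriv f x) x := fun x =>
    (h.sine.differentiable_val b x).hasDerivAt.real_of_complex.differentiableAt.hasDerivAt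
  have hsign : ∀ x, f x = 0 → 0 < deriv f x * (ds x b).re := fun x hx =>
    h.deriv_sine_mul_pos hab hV ((hreal x).1 hx)
  have hsimple : ∀ x, f x = 0 → deriv f x ≠ 0 := fun x hx =>
    left_ne_zero_of_mul (hsign x hx).ne'
  have hpos := h.eventually_sine_right_pos hab hV
  have hfreq := h.frequently_sine_right_eq_zero hab hV
  obtain ⟨m, hm⟩ := eventually_atBot.1 hpos
  obtain ⟨μ, hμ, hrange⟩ := exists_strictMono_range_eq (finite_zeros_inter_Icc hf hsimple)
    hfreq.exists ⟨m, fun x hx => (le_total m x).resolve_right fun hle => (hm x hle).ne' hx⟩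
    (not_bddAbove_iff.2 fun x => ((hfreq.and_eventually (eventually_gt_atTop x)).exists))
  refine ⟨μ, hμ, fun z => ⟨fun hz => ?_, ?_⟩, fun k => ?_⟩
  · have hzre : ((z.re : ℝ) : ℂ) = z :=
      Complex.ext rfl (h.im_eq_zero_of_sine_right_eq_zero hab hV hz).symm
    obtain ⟨k, hk⟩ := hrange.superset ((hreal z.re).2 (hzre ▸ hz))
    exact ⟨k, by rw [hk, hzre]⟩
  · rintro ⟨k, rfl⟩
    exact (hreal _).1 (hrange.subset (mem_range_self k))
  · have hderiv := neg_one_pow_mul_deriv_neg_of_zeros hf hsimple hpos hμ hrange k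
    have := hsign _ (hrange.subset (mem_range_self k))
    refine neg_of_mul_pos_right ?_ hderiv.le
    rw [mul_mul_mul_comm, ← mul_pow, neg_one_mul, neg_neg, one_pow, one_mul]
    exact this

end IsFundamentalSystem

section LocalMapping

theorem exists_hasStrictDerivAt_pow_eq {g : ℂ → ℂ} {x : ℂ} {C : ℝ} {m : ℕ} (hm : m ≠ 0)
    (hg : AnalyticAt ℂ g x) (hgx : g x = C) (hC : 0 < C) :
    ∃ (h : ℂ → ℂ) (ρ : ℝ), 0 < ρ ∧ h x = 0 ∧ HasStrictDerivAt h ρ x ∧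
      ∀ z, h z ^ m = (z - x) ^ m * g z := by
  have hroot : AnalyticAt ℂ (fun z => g z ^ (m : ℂ)⁻¹) x :=
    hg.cpow analyticAt_const (by simpa [hgx] using Complex.ofReal_mem_slitPlane.2 hC)
  refine ⟨fun z => (z - x) * g z ^ (m : ℂ)⁻¹, C ^ (m : ℝ)⁻¹, Real.rpow_pos_of_pos hC _, by simp,
    ?_, fun z => by rw [mul_pow, Complex.cpow_nat_inv_pow _ hm]⟩
  refine (HasStrictDerivAt.fun_mul ((hasStrictDerivAt_id x).sub_const x)
    hroot.hasStrictDerivAt).congr_deriv ?_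
  simp [hgx, Complex.ofReal_cpow hC.le]

theorem exists_local_right_inverse {h : ℂ → ℂ} {d x : ℂ} (hd : d ≠ 0)
    (hh : HasStrictDerivAt h d x) :
    ∃ φ : ℂ → ℂ, φ (h x) = x ∧ HasDerivAt φ d⁻¹ (h x) ∧ ∀ᶠ w in 𝓝 (h x), h (φ w) = w :=
  ⟨hh.localInverse h d x hd, (hh.hasStrictFDerivAt_equiv hd).localInverse_apply_image,
    (hh.to_localInverse hd).hasDerivAt, (hh.hasStrictFDerivAt_equiv hd).eventually_right_inverse⟩

theorem eventually_im_pos_comp_mul_ofReal {φ : ℂ → ℂ} {ρ : ℝ} {ω : ℂ} (hφ₀ : (φ 0).im = 0)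
    (hφ : HasDerivAt φ ρ 0) (hρ : 0 < ρ) (hω : 0 < ω.im) :
    ∀ᶠ t : ℝ in 𝓝[>] 0, 0 < (φ (t * ω)).im := by
  have hray : HasDerivAt (fun t : ℝ => (t : ℂ) * ω) ω 0 := by
    simpa using (Complex.ofRealCLM.hasDerivAt (x := (0 : ℝ))).mul_const ω
  have hcurve : HasDerivAt (fun t : ℝ => φ (t * ω)) (ρ * ω) 0 :=
    HasDerivAt.comp (h₂ := φ) 0 (by simpa using hφ) hray
  have him : HasDerivAt (fun t : ℝ => (φ (t * ω)).im) (ρ * ω.im) 0 := by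
    refine (Complex.imCLM.hasFDerivAt.comp_hasDerivAt 0 hcurve).congr_deriv ?_
    rw [Complex.imCLM_apply, Complex.im_ofReal_mul]
  simpa [hφ₀] using
    eventually_nhdsGT_lt_of_hasDerivWithinAt_pos him.hasDerivWithinAt (mul_pos hρ hω)

theorem exists_pow_eq_neg_one_of_im_pos {m : ℕ} (hm : 2 ≤ m) : ∃ ω : ℂ, ω ^ m = -1 ∧ 0 < ω.im := by
  have hm₀ : (m : ℂ) ≠ 0 := Nat.cast_ne_zero.2 (by lia)
  refine ⟨Complex.exp ((Real.pi / m : ℝ) * Complex.I), ?_, ?_⟩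
  · rw [← Complex.exp_nat_mul, ← Complex.exp_pi_mul_I]
    congr 1
    push_cast
    field_simp
  · rw [Complex.exp_ofReal_mul_I_im]
    exact Real.sin_pos_of_pos_of_lt_pi (by positivity)
      (div_lt_self Real.pi_pos (by exact_mod_cast hm))

variable {f g : ℂ → ℂ} {x C : ℝ} {m : ℕ}

/- In the coordinate `h` with `h ^ m = (z - x) ^ m * g z`, the preimage of the ray through
`exp (π i / m)` is a curve leaving `x` at the angle `π / m`, along which `f` is real. -/
theorem eventually_exists_im_pos_eq_sub_pow (hm : 2 ≤ m) (hg : AnalyticAt ℂ g x) (hgx : g x = C)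
    (hC : 0 < C) (hfg : ∀ᶠ z in 𝓝 (x : ℂ), f z = f x + (z - x) ^ m * g z) :
    ∀ᶠ t : ℝ in 𝓝[>] 0, ∃ z : ℂ, 0 < z.im ∧ f z = f x - (t : ℂ) ^ m := by
  obtain ⟨h, ρ, hρ, hx, hh, hpow⟩ :=
    exists_hasStrictDerivAt_pow_eq (m := m) (by lia) hg hgx hC
  obtain ⟨φ, hφ₀, hφ, hinv⟩ :=
    exists_local_right_inverse (Complex.ofReal_ne_zero.2 hρ.ne') hh
  rw [hx] at hφ₀ hφ hinv
  obtain ⟨ω, hω, hω_im⟩ := exists_pow_eq_neg_one_of_im_pos hm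
  have hray : Tendsto (fun t : ℝ => (t : ℂ) * ω) (𝓝[>] 0) (𝓝 0) :=
    (Continuous.tendsto' (by fun_prop) 0 0 (by simp)).mono_left nhdsWithin_le_nhds
  have hφ_tendsto : Tendsto φ (𝓝 0) (𝓝 x) := hφ₀ ▸ hφ.continuousAt.tendsto
  rw [← Complex.ofReal_inv] at hφ
  filter_upwards [eventually_im_pos_comp_mul_ofReal (by rw [hφ₀, Complex.ofReal_im]) hφ
      (inv_pos.2 hρ) hω_im, hray.eventually hinv, hray.eventually (hφ_tendsto.eventually hfg)]
    with t ht_im ht_inv ht_fac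
  refine ⟨φ (t * ω), ht_im, ?_⟩
  rw [ht_fac, ← hpow, ht_inv, mul_pow, hω]
  ring

theorem tendsto_comp_ofReal_nhdsGT (hg : ContinuousAt g x) :
    Tendsto (fun t : ℝ => g t) (𝓝[>] x) (𝓝 (g x)) :=
  (hg.comp Complex.continuous_ofReal.continuousAt).tendsto.mono_left nhdsWithin_le_nhds

theorem eventually_ofReal_sub_eq_pow_mul
    (hfg : ∀ᶠ z in 𝓝 (x : ℂ), f z = f x + (z - x) ^ m * g z) :
    ∀ᶠ t : ℝ in 𝓝[>] x, f t - f x = ((t - x) ^ m : ℝ) * g t := by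
  have hreal := (Complex.continuous_ofReal.tendsto x).eventually hfg
  filter_upwards [hreal.filter_mono nhdsWithin_le_nhds] with t ht
  rw [ht]
  push_cast
  ring

theorem im_eq_zero_of_eventually_eq_add_pow_mul (hf : ∀ t : ℝ, (f t).im = 0)
    (hg : ContinuousAt g x) (hfg : ∀ᶠ z in 𝓝 (x : ℂ), f z = f x + (z - x) ^ m * g z) :
    (g x).im = 0 := by
  refine tendsto_nhds_unique (((Complex.continuous_im.tendsto _).comp
    (tendsto_comp_ofReal_nhdsGT hg)).congr' ?_) tendsto_const_nhds
  filter_upwards [eventually_ofReal_sub_eq_pow_mul hfg, self_mem_nhdsWithin] with t ht hxt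
  have him := congrArg Complex.im ht
  rw [Complex.sub_im, hf, hf, sub_zero, Complex.im_ofReal_mul] at him
  exact (mul_eq_zero.1 him.symm).resolve_left (pow_pos (sub_pos.2 hxt) m).ne'

theorem re_nonneg_of_isLocalMin_of_eventually_eq_add_pow_mul
    (hmin : IsLocalMin (fun t : ℝ => (f t).re) x) (hg : ContinuousAt g x)
    (hfg : ∀ᶠ z in 𝓝 (x : ℂ), f z = f x + (z - x) ^ m * g z) : 0 ≤ (g x).re := by
  refine ge_of_tendsto ((Complex.continuous_re.tendsto _).comp (tendsto_comp_ofReal_nhdsGT hg)) ?_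
  filter_upwards [eventually_ofReal_sub_eq_pow_mul hfg, hmin.filter_mono nhdsWithin_le_nhds,
    self_mem_nhdsWithin] with t ht hle hxt
  have hre := congrArg Complex.re ht
  rw [Complex.sub_re, Complex.re_ofReal_mul] at hre
  exact nonneg_of_mul_nonneg_right (hre ▸ sub_nonneg.2 hle) (pow_pos (sub_pos.2 hxt) m)

theorem two_le_of_eventually_eq_add_pow_mul (hd : deriv f x = 0) (hg : DifferentiableAt ℂ g x)
    (hgx : g x ≠ 0) (hfg : ∀ᶠ z in 𝓝 (x : ℂ), f z = f x + (z - x) ^ m * g z) : 2 ≤ m := by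
  by_contra! hm
  interval_cases m
  · exact hgx (by simpa using hfg.self_of_nhds)
  · have hderiv : HasDerivAt (fun z : ℂ => f x + (z - x) ^ 1 * g z) (g x) x := by
      simpa using (((hasDerivAt_id (x : ℂ)).sub_const (x : ℂ)).mul hg.hasDerivAt).const_add (f x)
    exact hgx ((hderiv.congr_of_eventuallyEq hfg).deriv ▸ hd)

theorem exists_eventually_eq_add_pow_mul (hf : AnalyticAt ℂ f x) (hreal : ∀ t : ℝ, (f t).im = 0)
    (hconst : ¬∀ᶠ z in 𝓝 (x : ℂ), f z = f x) (hd : deriv f x = 0) :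
    ∃ (m : ℕ) (g : ℂ → ℂ) (C : ℝ), 2 ≤ m ∧ AnalyticAt ℂ g x ∧ C ≠ 0 ∧ g x = C ∧
      ∀ᶠ z in 𝓝 (x : ℂ), f z = f x + (z - x) ^ m * g z := by
  obtain ⟨m, g, hg, hgx, hfac⟩ :=
    (hf.sub analyticAt_const).exists_eventuallyEq_pow_smul_nonzero_iff.2
      (by simpa only [Pi.sub_apply, sub_eq_zero] using hconst)
  have hfg : ∀ᶠ z in 𝓝 (x : ℂ), f z = f x + (z - x) ^ m * g z :=
    hfac.mono fun z hz => sub_eq_iff_eq_add'.1 hz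
  have hgC : g x = (g x).re :=
    Complex.ext rfl (im_eq_zero_of_eventually_eq_add_pow_mul hreal hg.continuousAt hfg)
  exact ⟨m, g, (g x).re, two_le_of_eventually_eq_add_pow_mul hd hg.differentiableAt hgx hfg, hg,
    fun h => hgx (by rw [hgC, h, Complex.ofReal_zero]), hgC, hfg⟩

end LocalMapping

section Lyapunov

/-- The properties of the discriminant of a self-adjoint periodic problem: `f` is entire, real on
the real axis, and takes values in `[-B, B]` only on the real axis. -/
structure IsLyapunov (B : ℝ) (f : ℂ → ℂ) : Prop where
  differentiable : Differentiable ℂ f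
  im_ofReal : ∀ x : ℝ, (f x).im = 0
  im_eq_zero : ∀ z, (f z).im = 0 → |(f z).re| ≤ B → z.im = 0

namespace IsLyapunov

variable {B : ℝ} {f : ℂ → ℂ} {x : ℝ}

theorem neg (h : IsLyapunov B f) : IsLyapunov B (fun z => -f z) where
  differentiable := h.differentiable.fun_neg
  im_ofReal x := by simp [h.im_ofReal]
  im_eq_zero z him hre := h.im_eq_zero z (by simpa using him) (by simpa using hre)

theorem not_eventually_eq (h : IsLyapunov B f) (hx : |(f x).re| ≤ B) :
    ¬∀ᶠ z in 𝓝 (x : ℂ), f z = f x := by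
  intro hconst
  have hvert : Tendsto (fun t : ℝ => (x : ℂ) + t * Complex.I) (𝓝[>] 0) (𝓝 x) :=
    (Continuous.tendsto' (by fun_prop) 0 _ (by simp)).mono_left nhdsWithin_le_nhds
  obtain ⟨t, ht, ht₀⟩ := ((hvert.eventually hconst).and self_mem_nhdsWithin).exists
  have him := h.im_eq_zero _ (by rw [ht]; exact h.im_ofReal x) (by rwa [ht])
  exact (ne_of_gt ht₀) (by simpa using him)

theorem exists_eventually_eq (h : IsLyapunov B f) (hx : |(f x).re| ≤ B) (hd : deriv f x = 0) :
    ∃ (m : ℕ) (g : ℂ → ℂ) (C : ℝ), 2 ≤ m ∧ AnalyticAt ℂ g x ∧ C ≠ 0 ∧ g x = C ∧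
      ∀ᶠ z in 𝓝 (x : ℂ), f z = f x + (z - x) ^ m * g z :=
  exists_eventually_eq_add_pow_mul (h.differentiable.analyticAt x) h.im_ofReal
    (h.not_eventually_eq hx) hd

/- Otherwise `f` would take values in `[-B, f x)` at non-real points. -/
theorem re_eq_neg_of_pos (h : IsLyapunov B f) (hx : |(f x).re| ≤ B) {m : ℕ} {g : ℂ → ℂ} {C : ℝ}
    (hm : 2 ≤ m) (hg : AnalyticAt ℂ g x) (hgx : g x = C) (hC : 0 < C)
    (hfg : ∀ᶠ z in 𝓝 (x : ℂ), f z = f x + (z - x) ^ m * g z) : (f x).re = -B := by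
  by_contra hne
  have hgap : 0 < (f x).re + B := by
    linarith [lt_of_le_of_ne (abs_le.1 hx).1 (Ne.symm hne)]
  have hsmall : ∀ᶠ t : ℝ in 𝓝[>] 0, t ^ m < (f x).re + B :=
    ((continuous_pow m).tendsto' (0 : ℝ) 0 (zero_pow (by lia))).eventually (gt_mem_nhds hgap)
      |>.filter_mono nhdsWithin_le_nhds
  obtain ⟨t, ⟨⟨z, hz, hfz⟩, htB⟩, ht⟩ :=
    ((eventually_exists_im_pos_eq_sub_pow hm hg hgx hC hfg).and hsmall).and
      self_mem_nhdsWithin |>.exists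
  rw [← Complex.ofReal_pow] at hfz
  refine hz.ne' (h.im_eq_zero z ?_ ?_)
  · rw [hfz, Complex.sub_im, h.im_ofReal, Complex.ofReal_im, sub_zero]
  · rw [hfz, Complex.sub_re, Complex.ofReal_re, abs_le]
    constructor <;> linarith [pow_pos ht m, (abs_le.1 hx).2]

theorem deriv_ne_zero (h : IsLyapunov B f) (hx : |(f x).re| < B) : deriv f x ≠ 0 := by
  intro hd
  obtain ⟨m, g, C, hm, hg, hC, hgx, hfg⟩ := h.exists_eventually_eq hx.le hd
  rcases hC.lt_or_gt with hC | hC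
  · have hneg := h.neg.re_eq_neg_of_pos (by simpa using hx.le) hm hg.neg (C := -C) (by simp [hgx])
      (neg_pos.2 hC) (hfg.mono fun z hz => by rw [hz, Pi.neg_apply]; ring)
    rw [Complex.neg_re, neg_inj] at hneg
    exact (abs_lt.1 hx).2.ne hneg
  · exact (abs_lt.1 hx).1.ne' (h.re_eq_neg_of_pos hx.le hm hg hgx hC hfg)

theorem deriv_eq_zero_of_isLocalMin (h : IsLyapunov B f)
    (hmin : IsLocalMin (fun t : ℝ => (f t).re) x) : deriv f x = 0 := by
  have hf := (h.differentiable x).hasDerivAt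
  refine Complex.ext (hmin.hasDerivAt_eq_zero hf.real_of_complex) ?_
  have him : HasDerivAt (fun t : ℝ => (f t).im) (deriv f x).im x :=
    Complex.imCLM.hasFDerivAt.comp_hasDerivAt x hf.comp_ofReal
  simp only [h.im_ofReal] at him
  exact him.unique (hasDerivAt_const x 0)

theorem re_ne_of_isLocalMin (h : IsLyapunov B f) (hB : 0 < B)
    (hmin : IsLocalMin (fun t : ℝ => (f t).re) x) : (f x).re ≠ B := by
  intro hfx
  have hx : |(f x).re| ≤ B := by rw [hfx, abs_of_pos hB]
  obtain ⟨m, g, C, hm, hg, hC, hgx, hfg⟩ :=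
    h.exists_eventually_eq hx (h.deriv_eq_zero_of_isLocalMin hmin)
  have hC₀ : 0 ≤ C := by
    simpa [hgx] using
      re_nonneg_of_isLocalMin_of_eventually_eq_add_pow_mul hmin hg.continuousAt hfg
  linarith [h.re_eq_neg_of_pos hx hm hg hgx (hC₀.lt_of_ne' hC) hfg]

theorem re_ne_neg_of_isLocalMax (h : IsLyapunov B f) (hB : 0 < B)
    (hmax : IsLocalMax (fun t : ℝ => (f t).re) x) : (f x).re ≠ -B := fun hfx =>
  h.neg.re_ne_of_isLocalMin hB (by simpa using hmax.neg) (by simp [hfx])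

end IsLyapunov

end Lyapunov

section Spectrum

variable {H : Type*} [NormedAddCommGroup H] [NormedSpace ℂ H] {A : H →ₗ.[ℂ] H} {z : ℂ}

theorem isEigenvalue_iff_exists_mem_graph :
    IsEigenvalue A z ↔ ∃ u : H, u ≠ 0 ∧ (u, z • u) ∈ A.graph := by
  constructor
  · rintro ⟨u, hu, hAu⟩
    exact ⟨u, by simpa using hu, hAu ▸ A.mem_graph u⟩
  · rintro ⟨u, hu, hgraph⟩
    obtain ⟨v, rfl, hv⟩ := A.mem_graph_iff.1 hgraph
    exact ⟨v, by simpa using hu, hv⟩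

theorem IsEigenvalue.mem_spec (h : IsEigenvalue A z) : z ∈ spec A := by
  rintro ⟨R, hR⟩
  obtain ⟨u, hu, hgraph⟩ := isEigenvalue_iff_exists_mem_graph.1 h
  exact hu (by simpa using (hR u 0).1 (by simpa using hgraph))

end Spectrum

section Dirichlet

variable {l : ℝ} {V : ℝ → ℝ} {z : ℂ}

theorem mem_dirichletGraph_smul_iff {u : L2 l} :
    (u, z • u) ∈ dirichletGraph l V ↔ ∃ y p : ℝ → ℂ, IsSolution 0 l V z y p ∧ y 0 = 0 ∧ y l = 0 ∧
      (u : ℝ → ℂ) =ᵐ[volume.restrict (Icc 0 l)] y := by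
  constructor
  · rintro ⟨y, p, g, hg, hy₀, hyl, hu, hzu⟩
    refine ⟨y, p, ⟨g, hg, ?_⟩, hy₀, hyl, hu⟩
    filter_upwards [hu, hzu, Lp.coeFn_smul z u] with t hut hzut hsmul
    rw [← hzut, ← hut]
    exact hsmul
  · rintro ⟨y, p, ⟨g, hg, hode⟩, hy₀, hyl, hu⟩
    refine ⟨y, p, g, hg, hy₀, hyl, hu, ?_⟩
    filter_upwards [hu, hode, Lp.coeFn_smul z u] with t hut hodet hsmul
    rw [hodet, ← hut]
    exact hsmul

theorem IsSolution.memLp {a b : ℝ} {y p : ℝ → ℂ} (h : IsSolution a b V z y p) :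
    MemLp y 2 (volume.restrict (Icc a b)) := by
  obtain ⟨C, hC⟩ := isCompact_Icc.exists_bound_of_continuousOn h.continuousOn
  exact .of_bound (h.continuousOn.aestronglyMeasurable measurableSet_Icc) C
    (ae_restrict_of_forall_mem measurableSet_Icc hC)

theorem IsSolution.left_eq_zero_of_ae_eq_zero {a b : ℝ} (hab : a < b) {y p : ℝ → ℂ}
    (h : IsSolution a b V z y p) (hy : y =ᵐ[volume.restrict (Icc a b)] 0) : y a = 0 ∧ p a = 0 := by
  by_contra! hne
  have hpos := h.integral_normSq_pos hab (by tauto)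
  have hzero : (fun t => Complex.normSq (y t)) =ᵐ[volume.restrict (Icc a b)] 0 :=
    hy.mono fun t ht => Complex.normSq_eq_zero.2 ht
  rw [intervalIntegral.integral_of_le hab.le, ← integral_Icc_eq_integral_Ioc,
    integral_eq_zero_of_ae hzero] at hpos
  exact hpos.false

namespace IsFundamentalSystem

variable {c dc s ds : ℂ → ℝ → ℂ}

theorem isEigenvalue_dirichletOp_iff (hl : 0 < l) (hV : MemLp V 2 (volume.restrict (Icc 0 l)))
    (h : IsFundamentalSystem 0 l V c dc s ds) : IsEigenvalue (dirichletOp l V) z ↔ s z l = 0 := by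
  simp only [isEigenvalue_iff_exists_mem_graph, dirichletOp_graph hl, mem_dirichletGraph_smul_iff]
  constructor
  · rintro ⟨u, hu, y, p, hy, hy₀, hyl, huy⟩
    have hys : EqOn y (p 0 • s z) (Icc 0 l) := fun t ht => by
      simpa [hy₀] using (h.eq_combination hl.le hV hy ht).1
    have hp₀ : p 0 ≠ 0 := fun hp₀ => hu <| Lp.ext <| by
      filter_upwards [huy, ae_restrict_of_forall_mem measurableSet_Icc hys,
        Lp.coeFn_zero ℂ 2 (volume.restrict (Icc 0 l))] with t hut hyt h0t
      rw [hut, hyt, h0t, hp₀, zero_smul]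
    exact (smul_eq_zero.1 ((hys (right_mem_Icc.2 hl.le)).symm.trans hyl)).resolve_left hp₀
  · intro hz
    have hs := h.sine.isSolution z
    refine ⟨hs.memLp.toLp, fun hu => ?_, s z, ds z, hs, h.sine.val_left z, hz,
      hs.memLp.coeFn_toLp⟩
    have hs₀ := (hs.left_eq_zero_of_ae_eq_zero hl
      ((MemLp.toLp_eq_toLp_iff hs.memLp MemLp.zero').1 hu)).2
    exact one_ne_zero ((h.sine.der_left z).symm.trans hs₀)

theorem sine_right_ne_zero_of_notMem_spec (hl : 0 < l)
    (hV : MemLp V 2 (volume.restrict (Icc 0 l))) (h : IsFundamentalSystem 0 l V c dc s ds)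
    (hz : z ∉ spec (dirichletOp l V)) : s z l ≠ 0 := fun h₀ =>
  hz ((h.isEigenvalue_dirichletOp_iff hl hV).2 h₀).mem_spec

end IsFundamentalSystem

end Dirichlet

section Krein

variable {l : ℝ} {V : ℝ → ℝ} {z : ℂ}

theorem mulVec_fin_two {R : Type*} [NonUnitalNonAssocSemiring R] (a b c d : R) (v : Fin 2 → R) :
    !![a, b; c, d].mulVec v = ![a * v 0 + b * v 1, c * v 0 + d * v 1] := by
  ext i
  fin_cases i <;> simp [Matrix.mulVec, dotProduct, Fin.sum_univ_two]

theorem IsKreinMatrix.unique {S T : Matrix (Fin 2) (Fin 2) ℂ} (hS : IsKreinMatrix l V z S)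
    (hT : IsKreinMatrix l V z T) : S = T := by
  refine Matrix.ext_of_mulVec_single fun i => ?_
  obtain ⟨f, p, hf, hfi⟩ := hS.1 (Pi.single i 1)
  rw [← hfi, ← hS.2 f p hf, ← hT.2 f p hf]

theorem IsKreinMatrix.isKreinMatrix_kreinMatrix {S : Matrix (Fin 2) (Fin 2) ℂ}
    (hS : IsKreinMatrix l V z S) : IsKreinMatrix l V z (kreinMatrix l V z) := by
  have hex : ∃ S, IsKreinMatrix l V z S := ⟨S, hS⟩
  rw [kreinMatrix, dif_pos hex]
  exact hex.choose_spec

namespace IsFundamentalSystem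

variable {c dc s ds : ℂ → ℝ → ℂ}

theorem isKreinMatrix (hl : 0 ≤ l) (hV : MemLp V 2 (volume.restrict (Icc 0 l)))
    (h : IsFundamentalSystem 0 l V c dc s ds) (hz : s z l ≠ 0) :
    IsKreinMatrix l V z !![-c z l / s z l, 1 / s z l; 1 / s z l, -ds z l / s z l] := by
  refine ⟨fun v => ⟨_, _, h.isSolution_combination z (v 0) ((v 1 - v 0 * c z l) / s z l), ?_⟩,
    fun f p hf => ?_⟩
  · ext i
    fin_cases i
    · simp [h.cosine.val_left, h.sine.val_left]
    · simp [div_mul_cancel₀ _ hz]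
  · obtain ⟨hfl, hpl⟩ := h.eq_combination hl hV hf (right_mem_Icc.2 hl)
    have hW := h.wronskian_eq_one hl hV z
    rw [mulVec_fin_two]
    refine congrArg₂ (fun u w => ![u, w]) ?_ ?_
    · simp only [hfl, Matrix.cons_val_zero, Matrix.cons_val_one]
      field_simp
      ring
    · simp only [hfl, hpl, Matrix.cons_val_zero, Matrix.cons_val_one]
      field_simp
      linear_combination f 0 * hW

theorem kreinMatrix_eq (hl : 0 ≤ l) (hV : MemLp V 2 (volume.restrict (Icc 0 l)))
    (h : IsFundamentalSystem 0 l V c dc s ds) (hz : s z l ≠ 0) :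
    kreinMatrix l V z = !![-c z l / s z l, 1 / s z l; 1 / s z l, -ds z l / s z l] :=
  (h.isKreinMatrix hl hV hz).isKreinMatrix_kreinMatrix.unique (h.isKreinMatrix hl hV hz)

end IsFundamentalSystem

end Krein

section Cells

variable {a b : ℝ} {W : ℝ → ℝ} {z : ℂ} {y p : ℝ → ℂ}

theorem IsSolution.congr_potential {W' : ℝ → ℝ} (h : IsSolution a b W z y p)
    (hW : EqOn W W' (Ico a b)) : IsSolution a b W' z y p := by
  obtain ⟨g, hg, hode⟩ := h
  refine ⟨g, hg, ?_⟩
  rw [← Measure.restrict_congr_set Ico_ae_eq_Icc] at hode ⊢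
  filter_upwards [hode, ae_restrict_mem measurableSet_Ico] with t hodet ht
  rwa [← hW ht]

theorem IsSolution.congr {y' : ℝ → ℂ} (h : IsSolution a b W z y p) (hy : EqOn y' y (Icc a b)) :
    IsSolution a b W z y' p := by
  obtain ⟨g, hg, hode⟩ := h
  refine ⟨g, ⟨hg.memLp, fun t ht => (hg.hasDeriv t ht).congr hy (hy ht), hg.deriv_eq⟩, ?_⟩
  filter_upwards [hode, ae_restrict_mem measurableSet_Icc] with t hodet ht
  rwa [hy ht]

theorem IsSolution.translate (h : IsSolution a b W z y p) (d : ℝ) :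
    IsSolution (a + d) (b + d) (fun t => W (t - d)) z (fun t => y (t - d))
      (fun t => p (t - d)) := by
  obtain ⟨g, hg, hode⟩ := h
  have hpre : (fun t => t - d) ⁻¹' Icc a b = Icc (a + d) (b + d) := preimage_sub_const_Icc _ _ _
  have hmp : MeasurePreserving (fun t => t - d) (volume.restrict (Icc (a + d) (b + d)))
      (volume.restrict (Icc a b)) :=
    hpre ▸ (measurePreserving_sub_right volume d).restrict_preimage measurableSet_Icc
  have hmaps : MapsTo (fun t => t - d) (Icc (a + d) (b + d)) (Icc a b) := hpre.ge
  refine ⟨fun t => g (t - d), ⟨hg.memLp.comp_measurePreserving hmp, fun t ht => ?_,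
    fun t ht => ?_⟩, hmp.quasiMeasurePreserving.ae hode⟩
  · exact ((hg.hasDeriv (t - d) (hmaps ht)).scomp t
      ((hasDerivAt_id t).sub_const d).hasDerivWithinAt hmaps).congr_deriv (one_smul _ _)
  · rw [intervalIntegral.integral_comp_sub_right, add_sub_cancel_right]
    exact hg.deriv_eq _ (hmaps ht)

variable {l : ℝ} {V : ℝ → ℝ} {k : ℤ} {t : ℝ}

theorem floor_div_eq_of_mem_Ico (hl : 0 < l) (ht : t ∈ Ico (k * l) ((k + 1) * l)) :
    ⌊t / l⌋ = k := by
  rwa [Int.floor_eq_iff, le_div_iff₀ hl, div_lt_iff₀ hl]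

theorem periodize_of_mem_Ico (hl : 0 < l) (ht : t ∈ Ico (k * l) ((k + 1) * l)) :
    periodize l V t = V (t - k * l) := by
  rw [periodize, Int.fract, floor_div_eq_of_mem_Ico hl ht, mul_sub, mul_div_cancel₀ t hl.ne',
    mul_comm]

/-- The function on `ℝ` which on the cell `[k l, (k+1) l)` is the translate of `F k` on `[0,l)`. -/
def glue (l : ℝ) (F : ℤ → ℝ → ℂ) (t : ℝ) : ℂ := F ⌊t / l⌋ (t - ⌊t / l⌋ * l)

theorem glue_eqOn (hl : 0 < l) {F : ℤ → ℝ → ℂ} (hF : ∀ k, F (k + 1) 0 = F k l) (k : ℤ) :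
    EqOn (glue l F) (fun t => F k (t - k * l)) (Icc (k * l) ((k + 1) * l)) := by
  rintro t ⟨hkt, htk⟩
  rcases htk.lt_or_eq with hlt | rfl
  · simp only [glue, floor_div_eq_of_mem_Ico hl ⟨hkt, hlt⟩]
  · have hfloor : ⌊((k : ℝ) + 1) * l / l⌋ = k + 1 := by
      rw [mul_div_cancel_right₀ _ hl.ne', ← Int.cast_one, ← Int.cast_add, Int.floor_intCast]
    simp only [glue, hfloor, Int.cast_add, Int.cast_one, sub_self, hF]
    congr 1
    ring

theorem isKPSolution_glue (hl : 0 < l) {α : ℝ} {F G : ℤ → ℝ → ℂ}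
    (hF : ∀ k, IsSolution 0 l V z (F k) (G k)) (hval : ∀ k, F (k + 1) 0 = F k l)
    (hjump : ∀ k, G (k + 1) 0 = G k l + α * F (k + 1) 0) :
    IsKPSolution l V α z (glue l F) (fun k t => G k (t - k * l)) where
  cell k := by
    have hcell := (hF k).translate (k * l)
    rw [zero_add, show l + k * l = ((k : ℝ) + 1) * l by ring] at hcell
    exact (hcell.congr_potential fun t ht => (periodize_of_mem_Ico hl ht).symm).congr
      (glue_eqOn hl hval k)
  jump k := by
    have hleft : glue l F (k * l) = F k 0 := by
      simpa only [sub_self] using glue_eqOn hl hval k (left_mem_Icc.2 (by nlinarith))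
    have hk := hjump (k - 1)
    rw [sub_add_cancel] at hk
    rw [hleft, sub_self, hk]
    congr 2
    push_cast
    ring

theorem IsKPSolution.isSolution_zero {α : ℝ} {p : ℤ → ℝ → ℂ} (hl : 0 < l)
    (h : IsKPSolution l V α z y p) : IsSolution 0 l V z y (p 0) := by
  have hcell := h.cell 0
  simp only [Int.cast_zero, zero_mul, zero_add, one_mul] at hcell
  exact hcell.congr_potential fun t ht => by
    simpa using periodize_of_mem_Ico (V := V) (k := 0) hl (by simpa using ht)

theorem IsKPSolution.deriv_one_eq {α : ℝ} {p : ℤ → ℝ → ℂ} (h : IsKPSolution l V α z y p) :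
    p 1 l = p 0 l + α * y l := by
  simpa using h.jump 1

end Cells

section Monodromy

theorem exists_mul_star_eq_one_add_star_eq {d : ℝ} (hd : |d| ≤ 2) :
    ∃ ρ : ℂ, ρ * star ρ = 1 ∧ ρ + star ρ = d := by
  refine ⟨Complex.exp (Real.arccos (d / 2) * Complex.I), ?_, ?_⟩
  · rw [Complex.star_def, Complex.mul_conj, Complex.normSq_eq_norm_sq,
      Complex.norm_exp_ofReal_mul_I, one_pow, Complex.ofReal_one]
  · rw [Complex.star_def, Complex.add_conj, Complex.exp_ofReal_mul_I_re,
      Real.cos_arccos (by linarith [(abs_le.1 hd).1]) (by linarith [(abs_le.1 hd).2]),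
      mul_div_cancel₀ d two_ne_zero]

theorem exists_eigenvector_of_det_eq_one {M : Matrix (Fin 2) (Fin 2) ℂ} {d : ℝ} (hdet : M.det = 1)
    (htrace : M.trace = d) (hd : |d| ≤ 2) :
    ∃ (ρ : ℂ) (v : Fin 2 → ℂ), ρ * star ρ = 1 ∧ v ≠ 0 ∧ M.mulVec v = ρ • v := by
  obtain ⟨ρ, hmul, hadd⟩ := exists_mul_star_eq_one_add_star_eq hd
  rw [Matrix.trace_fin_two] at htrace
  rw [Matrix.det_fin_two] at hdet
  have hroot : (M - ρ • (1 : Matrix (Fin 2) (Fin 2) ℂ)).det = 0 := by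
    simp only [Matrix.det_fin_two, Matrix.sub_apply, Matrix.smul_apply, Matrix.one_apply_eq,
      Matrix.one_apply_ne zero_ne_one, Matrix.one_apply_ne one_ne_zero, smul_eq_mul, mul_one,
      mul_zero, sub_zero]
    linear_combination hdet - ρ * htrace + ρ * hadd - hmul
  obtain ⟨v, hv, hker⟩ := Matrix.exists_mulVec_eq_zero_iff.2 hroot
  rw [Matrix.sub_mulVec, Matrix.smul_mulVec, Matrix.one_mulVec, sub_eq_zero] at hker
  exact ⟨ρ, v, hmul, hv, hker⟩

variable {l : ℝ} {V : ℝ → ℝ} {c dc s ds : ℂ → ℝ → ℂ} {z : ℂ}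

theorem IsMonodromy.unique {α : ℝ} {M N : Matrix (Fin 2) (Fin 2) ℂ}
    (hM : IsMonodromy l V α z M) (hN : IsMonodromy l V α z N) : M = N := by
  obtain ⟨y₁, p₁, y₂, p₂, hy⟩ := hM.1
  rw [hM.2 _ _ _ _ hy, hN.2 _ _ _ _ hy]

theorem IsMonodromy.isMonodromy_monodromy {α : ℝ} {M : Matrix (Fin 2) (Fin 2) ℂ}
    (hM : IsMonodromy l V α z M) : IsMonodromy l V α z (monodromy l V α z) := by
  have hex : ∃ M, IsMonodromy l V α z M := ⟨M, hM⟩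
  rw [monodromy, dif_pos hex]
  exact hex.choose_spec

/-- The matrix taking `(y'(0+), y(0))` to `(y'(l+), y(l))` for the solutions `y` of
`-y'' + V y = z y` on `[0,l]` followed by the jump `y'(l+) = y'(l-) + α y(l)`. -/
def transferMatrix (l α : ℝ) (c dc s ds : ℂ → ℝ → ℂ) (z : ℂ) : Matrix (Fin 2) (Fin 2) ℂ :=
  !![ds z l + α * s z l, dc z l + α * c z l; s z l, c z l]

theorem transferMatrix_mulVec (α : ℝ) (v : Fin 2 → ℂ) :
    (transferMatrix l α c dc s ds z).mulVec v =
      ![v 1 * dc z l + v 0 * ds z l + α * (v 1 * c z l + v 0 * s z l),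
        v 1 * c z l + v 0 * s z l] := by
  rw [transferMatrix, mulVec_fin_two]
  refine congrArg₂ (fun u w => ![u, w]) ?_ ?_ <;> ring

namespace IsFundamentalSystem

theorem det_transferMatrix (hl : 0 ≤ l) (hV : MemLp V 2 (volume.restrict (Icc 0 l)))
    (h : IsFundamentalSystem 0 l V c dc s ds) (α : ℝ) (z : ℂ) :
    (transferMatrix l α c dc s ds z).det = 1 := by
  rw [transferMatrix, Matrix.det_fin_two_of]
  linear_combination h.wronskian_eq_one hl hV z

theorem exists_isKPSolution (hl : 0 < l) (hV : MemLp V 2 (volume.restrict (Icc 0 l)))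
    (h : IsFundamentalSystem 0 l V c dc s ds) (α : ℝ) (z y₀ p₀ : ℂ) :
    ∃ y p, IsKPSolution l V α z y p ∧ y 0 = y₀ ∧ p 0 0 = p₀ := by
  set M := transferMatrix l α c dc s ds z
  have hM : IsUnit M.det := h.det_transferMatrix hl.le hV α z ▸ isUnit_one
  set v : ℤ → Fin 2 → ℂ := fun k => (M ^ k).mulVec ![p₀, y₀]
  have hv₀ : v 0 = ![p₀, y₀] := by simp only [v, zpow_zero, Matrix.one_mulVec]
  have hv : ∀ k, v (k + 1) = ![v k 1 * dc z l + v k 0 * ds z l +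
      α * (v k 1 * c z l + v k 0 * s z l), v k 1 * c z l + v k 0 * s z l] := fun k => by
    rw [← transferMatrix_mulVec, add_comm]
    simp only [v, Matrix.zpow_one_add hM, Matrix.mulVec_mulVec, M]
  set F : ℤ → ℝ → ℂ := fun k => v k 1 • c z + v k 0 • s z
  set G : ℤ → ℝ → ℂ := fun k => v k 1 • dc z + v k 0 • ds z
  have hF₀ : ∀ k, F k 0 = v k 1 := fun k => by simp [F, h.cosine.val_left, h.sine.val_left]
  have hG₀ : ∀ k, G k 0 = v k 0 := fun k => by simp [G, h.cosine.der_left, h.sine.der_left]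
  refine ⟨glue l F, fun k t => G k (t - k * l),
    isKPSolution_glue hl (fun k => h.isSolution_combination z (v k 1) (v k 0)) (fun k => ?_)
      (fun k => ?_), ?_, ?_⟩
  · simp [hF₀, hv, F]
  · simp [hF₀, hG₀, hv, G]
  · simp [glue, hF₀, hv₀]
  · simp [hG₀, hv₀]

theorem isMonodromy (hl : 0 < l) (hV : MemLp V 2 (volume.restrict (Icc 0 l)))
    (h : IsFundamentalSystem 0 l V c dc s ds) (α : ℝ) (z : ℂ) :
    IsMonodromy l V α z (transferMatrix l α c dc s ds z) := by
  refine ⟨?_, fun y₁ p₁ y₂ p₂ hy => ?_⟩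
  · obtain ⟨y₁, p₁, h₁, h₁y, h₁p⟩ := h.exists_isKPSolution hl hV α z 0 1
    obtain ⟨y₂, p₂, h₂, h₂y, h₂p⟩ := h.exists_isKPSolution hl hV α z 1 0
    exact ⟨y₁, p₁, y₂, p₂, h₁, h₂, h₁y, h₁p, h₂y, h₂p⟩
  · have hlmem := right_mem_Icc.2 hl.le
    obtain ⟨hy₁, hp₁⟩ := h.eq_combination hl.le hV (hy.sol₁.isSolution_zero hl) hlmem
    obtain ⟨hy₂, hp₂⟩ := h.eq_combination hl.le hV (hy.sol₂.isSolution_zero hl) hlmem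
    rw [hy.sol₁.deriv_one_eq, hy.sol₂.deriv_one_eq, hy₁, hp₁, hy₂, hp₂, hy.val₁, hy.der₁, hy.val₂,
      hy.der₂, transferMatrix]
    simp only [zero_mul, one_mul, zero_add, add_zero]

theorem monodromy_eq (hl : 0 < l) (hV : MemLp V 2 (volume.restrict (Icc 0 l)))
    (h : IsFundamentalSystem 0 l V c dc s ds) (α : ℝ) (z : ℂ) :
    monodromy l V α z = transferMatrix l α c dc s ds z :=
  (h.isMonodromy hl hV α z).isMonodromy_monodromy.unique (h.isMonodromy hl hV α z)

theorem im_eq_zero_of_transferMatrix_mulVec_eq_smul (hl : 0 < l)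
    (hV : MemLp V 2 (volume.restrict (Icc 0 l))) (h : IsFundamentalSystem 0 l V c dc s ds) {α : ℝ}
    {ρ : ℂ} {v : Fin 2 → ℂ} (hρ : ρ * star ρ = 1) (hv : v ≠ 0)
    (hMv : (transferMatrix l α c dc s ds z).mulVec v = ρ • v) : z.im = 0 := by
  rw [transferMatrix_mulVec] at hMv
  have hyl : v 1 * c z l + v 0 * s z l = ρ * v 1 := congrFun hMv 1
  have hpl : v 1 * dc z l + v 0 * ds z l = ρ * v 0 - α * (ρ * v 1) := by
    rw [← hyl]
    exact eq_sub_of_add_eq (congrFun hMv 0)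
  refine (h.isSolution_combination z (v 1) (v 0)).im_eq_zero hl hV ?_ ?_
  · contrapose! hv
    ext i
    fin_cases i
    · simpa [h.cosine.der_left, h.sine.der_left] using hv.2
    · simpa [h.cosine.val_left, h.sine.val_left] using hv.1
  · simp only [Pi.add_apply, Pi.smul_apply, smul_eq_mul, hyl, hpl, h.cosine.val_left,
      h.cosine.der_left, h.sine.val_left, h.sine.der_left, mul_one, mul_zero, add_zero, zero_add,
      star_sub, star_mul', Complex.star_def, Complex.conj_ofReal]
    rw [Complex.star_def] at hρ
    linear_combination (v 1 * starRingEnd ℂ (v 0) - v 0 * starRingEnd ℂ (v 1)) * hρ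

theorem im_eq_zero_of_abs_trace_le_two (hl : 0 < l) (hV : MemLp V 2 (volume.restrict (Icc 0 l)))
    (h : IsFundamentalSystem 0 l V c dc s ds) {α d : ℝ}
    (htrace : (transferMatrix l α c dc s ds z).trace = d) (hd : |d| ≤ 2) : z.im = 0 := by
  obtain ⟨ρ, v, hρ, hv, hMv⟩ :=
    exists_eigenvector_of_det_eq_one (h.det_transferMatrix hl.le hV α z) htrace hd
  exact h.im_eq_zero_of_transferMatrix_mulVec_eq_smul hl hV hρ hv hMv

end IsFundamentalSystem

end Monodromy

section Eta

theorem add_le_neg_two_of_mul_eq_one {u v : ℝ} (huv : u * v = 1) (hv : v < 0) : u + v ≤ -2 := by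
  nlinarith [sq_nonneg (v + 1), inv_neg''.2 hv, eq_inv_of_mul_eq_one_left huv]

/-- The entire extension of `kreinEta`, in terms of the fundamental system at the right endpoint. -/
def eta (l α β : ℝ) (c s ds : ℂ → ℝ → ℂ) (z : ℂ) : ℂ :=
  α * s z l + ((1 + β ^ 2 : ℝ) : ℂ) * (c z l + ds z l)

variable {l : ℝ} {V : ℝ → ℝ} {c dc s ds : ℂ → ℝ → ℂ} {z : ℂ}

namespace IsFundamentalSystem

theorem kreinEta_eq_eta (hl : 0 ≤ l) (hV : MemLp V 2 (volume.restrict (Icc 0 l)))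
    (h : IsFundamentalSystem 0 l V c dc s ds) (α β : ℝ) (hz : s z l ≠ 0) :
    kreinEta l V α β z = eta l α β c s ds z := by
  have h₀₀ : kreinMatrix l V z 0 0 = -c z l / s z l := by rw [h.kreinMatrix_eq hl hV hz]; rfl
  have h₀₁ : kreinMatrix l V z 0 1 = 1 / s z l := by rw [h.kreinMatrix_eq hl hV hz]; rfl
  have h₁₁ : kreinMatrix l V z 1 1 = -ds z l / s z l := by rw [h.kreinMatrix_eq hl hV hz]; rfl
  rw [kreinEta, eta, h₀₀, h₀₁, h₁₁]
  push_cast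
  field_simp
  ring

theorem trace_transferMatrix (α β : ℝ) (z : ℂ) :
    (transferMatrix l (α / (1 + β ^ 2)) c dc s ds z).trace =
      eta l α β c s ds z / ((1 + β ^ 2 : ℝ) : ℂ) := by
  have hβ : ((1 + β ^ 2 : ℝ) : ℂ) ≠ 0 := Complex.ofReal_ne_zero.2 (by positivity)
  rw [transferMatrix, Matrix.trace_fin_two_of, eta, Complex.ofReal_div]
  field_simp
  ring

theorem discriminant_eq (hl : 0 < l) (hV : MemLp V 2 (volume.restrict (Icc 0 l)))
    (h : IsFundamentalSystem 0 l V c dc s ds) (α β : ℝ) (z : ℂ) :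
    discriminant l V (α / (1 + β ^ 2)) z = eta l α β c s ds z / ((1 + β ^ 2 : ℝ) : ℂ) := by
  rw [discriminant, h.monodromy_eq hl hV, trace_transferMatrix]

theorem isLyapunov_eta (hl : 0 < l) (hV : MemLp V 2 (volume.restrict (Icc 0 l)))
    (h : IsFundamentalSystem 0 l V c dc s ds) (α β : ℝ) :
    IsLyapunov (2 * (1 + β ^ 2)) (eta l α β c s ds) where
  differentiable := ((h.sine.differentiable_val l).const_mul _).add
    (((h.cosine.differentiable_val l).add (h.sine.differentiable_der l)).const_mul _)
  im_ofReal x := by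
    obtain ⟨hc, hs, hds⟩ := h.im_right_eq_zero hl.le hV x
    rw [eta, Complex.add_im, Complex.im_ofReal_mul, Complex.im_ofReal_mul, Complex.add_im, hc, hs,
      hds, add_zero, mul_zero, mul_zero, add_zero]
  im_eq_zero z hz hle := by
    have hβ : (0 : ℝ) < 1 + β ^ 2 := by positivity
    refine h.im_eq_zero_of_abs_trace_le_two hl hV (α := α / (1 + β ^ 2))
      (d := (eta l α β c s ds z).re / (1 + β ^ 2)) ?_ ?_
    · rw [trace_transferMatrix, Complex.ofReal_div]
      exact congrArg (· / _) (Complex.ext (Complex.ofReal_re _).symm hz)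
    · rwa [abs_div, abs_of_pos hβ, div_le_iff₀ hβ]

theorem neg_one_pow_mul_re_eta_le (hl : 0 ≤ l) (hV : MemLp V 2 (volume.restrict (Icc 0 l)))
    (h : IsFundamentalSystem 0 l V c dc s ds) (α β : ℝ) {x : ℝ} {k : ℕ} (hx : s x l = 0)
    (hk : (-1) ^ k * (ds x l).re < 0) :
    (-1) ^ k * (eta l α β c s ds x).re ≤ -2 * (1 + β ^ 2) := by
  have hre : (c x l).re * (ds x l).re = 1 := by
    have hw := congrArg Complex.re (h.wronskian_eq_one hl hV x)
    rwa [hx, mul_zero, sub_zero, Complex.mul_re, (h.im_right_eq_zero hl hV x).1, zero_mul, sub_zero,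
      Complex.one_re] at hw
  have hsum : (-1) ^ k * (c x l).re + (-1) ^ k * (ds x l).re ≤ -2 := by
    refine add_le_neg_two_of_mul_eq_one ?_ hk
    rw [mul_mul_mul_comm, ← mul_pow, hre, neg_one_mul, neg_neg, one_pow, one_mul]
  rw [eta, hx, mul_zero, zero_add, Complex.re_ofReal_mul, Complex.add_re]
  calc (-1) ^ k * ((1 + β ^ 2) * ((c x l).re + (ds x l).re))
      = ((-1) ^ k * (c x l).re + (-1) ^ k * (ds x l).re) * (1 + β ^ 2) := by ring
    _ ≤ -2 * (1 + β ^ 2) := by gcongr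

end IsFundamentalSystem

end Eta

end KreinKP

end

theorem mainTheorem5 (l : ℝ) (hl : 0 < l) (V : ℝ → ℝ)
    (hV : MeasureTheory.MemLp V 2 (MeasureTheory.volume.restrict (Set.Icc 0 l))) :
    -- the Krein matrix `s(z)` is well defined off `spec D`
    (∀ z ∉ KreinKP.spec (KreinKP.dirichletOp l V),
      KreinKP.IsKreinMatrix l V z (KreinKP.kreinMatrix l V z)) ∧
    -- (A)
    (∀ z ∉ KreinKP.spec (KreinKP.dirichletOp l V), KreinKP.kreinMatrix l V z 0 1 ≠ 0) ∧
    -- the eigenvalues `μ₀ < μ₁ < …` of `D`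
    ∃ μ : ℕ → ℝ, StrictMono μ ∧
      (∀ z : ℂ, KreinKP.IsEigenvalue (KreinKP.dirichletOp l V) z ↔ ∃ k, z = (μ k : ℂ)) ∧
      ∀ α β : ℝ, β ≠ 0 → ∃ η : ℂ → ℂ,
        -- (B)
        Differentiable ℂ η ∧
        (∀ z ∉ KreinKP.spec (KreinKP.dirichletOp l V), η z = KreinKP.kreinEta l V α β z) ∧
        -- (C)
        (∀ z : ℂ, KreinKP.IsMonodromy l V (α / (1 + β ^ 2)) z
          (KreinKP.monodromy l V (α / (1 + β ^ 2)) z)) ∧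
        (∀ z : ℂ, 1 / (1 + (β : ℂ) ^ 2) * η z =
          KreinKP.discriminant l V (α / (1 + β ^ 2)) z) ∧
        -- `η` is real on the real axis
        (∀ x : ℝ, (η x).im = 0) ∧
        -- (D)
        (∀ k, Even k → (η (μ k)).re ≤ -2 * (1 + β ^ 2)) ∧
        (∀ k, Odd k → 2 * (1 + β ^ 2) ≤ (η (μ k)).re) ∧
        -- (E)
        (∀ x : ℝ, |(η x).re| < 2 * (1 + β ^ 2) → deriv η x ≠ 0) ∧
        (∀ x : ℝ, IsLocalMin (fun t : ℝ => (η t).re) x → (η x).re ≠ 2 * (1 + β ^ 2)) ∧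
        (∀ x : ℝ, IsLocalMax (fun t : ℝ => (η t).re) x → (η x).re ≠ -2 * (1 + β ^ 2)) := by
  obtain ⟨c, dc, s, ds, h⟩ := KreinKP.exists_isFundamentalSystem hl.le hV
  obtain ⟨μ, hμ_mono, hμ_zero, hμ_sign⟩ := h.exists_strictMono_sine_right_zeros hl hV
  have hs : ∀ z ∉ KreinKP.spec (KreinKP.dirichletOp l V), s z l ≠ 0 := fun z hz =>
    h.sine_right_ne_zero_of_notMem_spec hl hV hz
  refine ⟨fun z hz => (h.isKreinMatrix hl.le hV (hs z hz)).isKreinMatrix_kreinMatrix,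
    fun z hz => ?_, μ, hμ_mono, fun z => (h.isEigenvalue_dirichletOp_iff hl hV).trans (hμ_zero z),
    fun α β _ => ?_⟩
  · rw [h.kreinMatrix_eq hl.le hV (hs z hz)]
    exact one_div_ne_zero (hs z hz)
  have hη := h.isLyapunov_eta hl hV α β
  have hβ : 0 < 2 * (1 + β ^ 2) := by positivity
  have hημ : ∀ k, (-1) ^ k * (KreinKP.eta l α β c s ds (μ k)).re ≤ -2 * (1 + β ^ 2) := fun k =>
    h.neg_one_pow_mul_re_eta_le hl.le hV α β ((hμ_zero _).2 ⟨k, rfl⟩) (hμ_sign k)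
  refine ⟨KreinKP.eta l α β c s ds, hη.differentiable,
    fun z hz => (h.kreinEta_eq_eta hl.le hV α β (hs z hz)).symm,
    fun z => (h.isMonodromy hl hV _ z).isMonodromy_monodromy, fun z => ?_, hη.im_ofReal,
    fun k hk => ?_, fun k hk => ?_, fun x => hη.deriv_ne_zero,
    fun x => hη.re_ne_of_isLocalMin hβ, fun x hx => ?_⟩
  · rw [h.discriminant_eq hl hV]
    push_cast
    ring
  · simpa only [hk.neg_one_pow, one_mul] using hημ k
  · simpa only [hk.neg_one_pow, neg_mul, one_mul, neg_le_neg_iff] using hημ k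
  · simpa only [neg_mul] using hη.re_ne_neg_of_isLocalMax hβ hx
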